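/- Let $(\mathcal T_t)_{t\ge 0}$ be a quantum Markov semigroup on $M_2=M_2(\mathbb C)$, i.e. a $w^*$-continuous one-parameter semigroup of completely positive linear maps on $M_2$ preserving the identity. For a positive matrix $\rho\in M_2$ of trace one let $\omega_\rho(x)=\operatorname{tr}(\rho x)$ be the corresponding state, let $\mathcal T_{*t}(\omega)=\omega\circ\mathcal T_t$, and let $\widetilde{\mathcal T}_{*t}$ be the linear map on $M_2$ with $\operatorname{tr}(\widetilde{\mathcal T}_{*t}(\rho)x)=\operatorname{tr}(\rho\,\mathcal T_t(x))$ for all $\rho,x\in M_2$. Suppose that the pure state $\omega_{|e_1\rangle\langle e_1|}$, $\|e_1\|=1$, is absorbing: $\lim_{t\to\infty}\mathcal T_{*t}(\omega)=\omega_{|e_1\rangle\langle e_1|}$ for every state $\omega$. Let $e_2$ be a unit vector orthogonal to $e_1$. Then there exist $y,z_1,z_2\in M_2$ such that the generator $\widetilde{\mathcal L}_*$ of $(\widetilde{\mathcal T}_{*t})$ is $$\widetilde{\mathcal L}_*(\rho)=y\rho+\rho y^*+\sum_{i=1}^2 z_i\rho z_i^*\quad(\rho\in M_2),\qquad\text{and}\qquad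 ye_1=y^*e_1=z_1e_1=z_2e_1=0.$$ For any such $y,z_1,z_2$, let $\eta$ be the greatest eigenvalue of $-(y+y^*)$ and $a=|\langle z_1e_2,e_2\rangle|^2+|\langle z_2e_2,e_2\rangle|^2$. Then $\eta-a>0$, and the following holds for every state $\omega_\rho\ne\omega_{|e_1\rangle\langle e_1|}$. Let $P$ be the set of pure states of $M_2$ with the weak$^*$ topology. For each $t\ge0$ let $\mu_{t,\rho}$ be an orthogonal measure representing $\mathcal T_{*t}(\omega_\rho)$, i.e. $\mu_{t,\rho}=\sum_{i=1}^2 a_{i,t}\,\delta_{\omega_{|e_{i,t}\rangle\langle e_{i,t}|}}$ where $\widetilde{\mathcal T}_{*t}(\rho)=\sum_{i=1}^2 a_{i,t}|e_{i,t}\rangle\langle e_{i,t}|$ with $(e_{1,t},e_{2,t})$ an orthonormal basis of $\mathbb C^2$. Then $(\mu_{t,\rho})$ satisfies a large deviation principle on $P$ with powers $1/t$ and rate function $$J(\omega_{|e\rangle\langle e|})=\begin{cases}0&\text{if }|e\rangle\langle e|=|e_1\rangle\langle e_1|,\\ \eta-a&\text{if }|e\rangle\langle e|=|e_2\rangle\langle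 e_2|,\\ +\infty&\text{otherwise,}\end{cases}$$ that is, $J$ is lower semicontinuous, $\limsup_{t\to\infty}\mu_{t,\rho}(F)^{1/t}\le\sup_{F}e^{-J}$ for all closed $F\subset P$, and $\liminf_{t\to\infty}\mu_{t,\rho}(G)^{1/t}\ge\sup_{G}e^{-J}$ for all open $G\subset P$. In particular $J$ does not depend on $\rho$. Moreover, for each open $G\subset P$ with $\omega_{|e_2\rangle\langle e_2|}\in G$ and $\omega_{|e_1\rangle\langle e_1|}\notin\overline G$, $$\lim_{t\to\infty}\frac1t\log\mu_{t,\rho}(G)=\lim_{t\to\infty}\frac1t\log a_{2,t,\rho}=a-\eta,$$ where $a_{2,t,\rho}$ is the least eigenvalue of $\widetilde{\mathcal T}_{*t}(\rho)$. -/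

import Mathlib

open Filter Topology MeasureTheory
open scoped NNReal ENNReal Matrix ComplexOrder MatrixOrder Matrix.Norms.L2Operator CStarAlgebra

namespace QMS

/-- The algebra `M_2`, with its usual C*-algebra structure and order. -/
abbrev M2 : Type := Matrix (Fin 2) (Fin 2) ℂ

/-- The Hilbert space `ℂ²`. -/
abbrev H2 : Type := EuclideanSpace ℂ (Fin 2)

/-- The action of a matrix on the Hilbert space. -/
noncomputable abbrev act (x : M2) (v : H2) : H2 := Matrix.toEuclideanLin x v

/-- The rank-one operator `|e⟩⟨e|`. -/
def ketbra (e : H2) : M2 := Matrix.vecMulVec e.ofLp (star e.ofLp)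

/-! ### States -/

/-- The state space of `M_2`, in the dual with its weak-* topology. -/
def stateSpace : Set (WeakDual ℂ M2) :=
  {ω | (∀ x : M2, 0 ≤ x → 0 ≤ ω x) ∧ ω 1 = 1}

/-- Density matrices: positive and of trace one. -/
def IsDensity (ρ : M2) : Prop := ρ.PosSemidef ∧ ρ.trace = 1

/-- The functional `ω_ρ : x ↦ tr (ρ x)`. -/
noncomputable def densityState (ρ : M2) : WeakDual ℂ M2 :=
  StrongDual.toWeakDual (LinearMap.toContinuousLinearMap
    (Matrix.traceLinearMap (Fin 2) ℂ ℂ ∘ₗ LinearMap.mulLeft ℂ ρ))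

lemma densityState_apply (ρ x : M2) : densityState ρ x = (ρ * x).trace := rfl

/-- The functional `ω_{|e⟩⟨e|} : x ↦ ⟨e, x e⟩`. -/
noncomputable def vectorState (e : H2) : WeakDual ℂ M2 := densityState (ketbra e)

lemma ketbra_mul_mul (e : H2) (x : M2) :
    ketbra e * x * ketbra e = (vectorState e x) • ketbra e := by
  ext i j
  fin_cases i <;> fin_cases j <;>
    simp [vectorState, densityState_apply, ketbra, Matrix.mul_apply, Matrix.vecMulVec_apply,
      Matrix.trace, Fin.sum_univ_two] <;> ring

lemma ketbra_trace {e : H2} (he : ‖e‖ = 1) : (ketbra e).trace = 1 := by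
  have h := EuclideanSpace.norm_sq_eq e
  rw [he, Fin.sum_univ_two] at h
  have h' : (1 : ℂ) = (‖e 0‖ : ℂ) ^ 2 + (‖e 1‖ : ℂ) ^ 2 := by exact_mod_cast (by simpa using h)
  rw [h']
  simp only [ketbra, Matrix.trace, Matrix.diag, Matrix.vecMulVec_apply, Fin.sum_univ_two,
    Pi.star_apply, RCLike.star_def, Complex.mul_conj']

lemma ketbra_posSemidef (e : H2) : (ketbra e).PosSemidef :=
  Matrix.posSemidef_vecMulVec_self_star _

lemma vectorState_apply (e : H2) (x : M2) :
    vectorState e x = star e.ofLp ⬝ᵥ (x *ᵥ e.ofLp) := by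
  simp [vectorState, densityState_apply, ketbra, Matrix.mul_apply, Matrix.vecMulVec_apply,
      Matrix.trace, Fin.sum_univ_two, Matrix.mulVec, dotProduct]
  ring

lemma vectorState_mem_stateSpace {e : H2} (he : ‖e‖ = 1) : vectorState e ∈ stateSpace := by
  refine ⟨fun x hx => ?_, ?_⟩
  · rw [vectorState_apply]
    exact (Matrix.nonneg_iff_posSemidef.mp hx).dotProduct_mulVec_nonneg _
  · rw [vectorState, densityState_apply, mul_one, ketbra_trace he]

lemma ketbra_idem {e : H2} (he : ‖e‖ = 1) : ketbra e * ketbra e = ketbra e := by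
  have h := ketbra_mul_mul e 1
  rw [mul_one, (vectorState_mem_stateSpace he).2, one_smul] at h
  exact h

/-- A state that vanishes on a projection `q` vanishes on `q y` and on `y q`. -/
lemma state_null {ω : WeakDual ℂ M2} (hω : ω ∈ stateSpace) {q : M2} (hq : star q = q)
    (hqq : q * q = q) (h0 : ω q = 0) (y : M2) : ω (q * y) = 0 ∧ ω (star y * q) = 0 := by
  set A := ω (q * y) with hA
  set B := ω (star y * q) with hB
  set C := ω (star y * y) with hC
  have hC0 : 0 ≤ C := hω.1 _ (star_mul_self_nonneg y)
  have key : ∀ w : ℂ, 0 ≤ w * A + star w * B + star w * w * C := by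
    intro w
    have h := hω.1 _ (star_mul_self_nonneg (q + w • y))
    have e1 : star (q + w • y) * (q + w • y)
        = q + w • (q * y) + star w • (star y * q) + (star w * w) • (star y * y) := by
      rw [star_add, star_smul, hq]
      simp only [add_mul, mul_add, hqq, smul_mul_assoc, mul_smul_comm]
      module
    rw [e1] at h
    simpa [map_add, map_smul, h0, ← hA, ← hB, ← hC] using h
  obtain ⟨hCr, hCi⟩ := Complex.nonneg_iff.mp hC0
  have k1 := (Complex.nonneg_iff.mp (key 1)).2
  have kI := (Complex.nonneg_iff.mp (key Complex.I)).2
  simp [← hCi] at k1 kI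
  have hBr : B.re = A.re := by linarith
  have hBi : B.im = -A.im := by linarith
  have kr : ∀ r : ℝ, 0 ≤ -2 * r * (A.re ^ 2 + A.im ^ 2)
      + r ^ 2 * (A.re ^ 2 + A.im ^ 2) * C.re := by
    intro r
    have h := (Complex.nonneg_iff.mp (key (-(r : ℂ) * star A))).1
    simp [hBr, hBi, ← hCi] at h
    nlinarith [h]
  have hz : A.re ^ 2 + A.im ^ 2 = 0 := by
    by_contra hne
    have hpos : 0 < A.re ^ 2 + A.im ^ 2 := lt_of_le_of_ne (by positivity) (Ne.symm hne)
    have h := kr (1 / (C.re + 1))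
    have hc : 0 < C.re + 1 := by linarith
    have : -2 * (1 / (C.re + 1)) * (A.re ^ 2 + A.im ^ 2)
      + (1 / (C.re + 1)) ^ 2 * (A.re ^ 2 + A.im ^ 2) * C.re
      = -((A.re ^ 2 + A.im ^ 2) * (C.re + 2)) / (C.re + 1) ^ 2 := by
        field_simp
        ring
    rw [this] at h
    have : -((A.re ^ 2 + A.im ^ 2) * (C.re + 2)) / (C.re + 1) ^ 2 < 0 := by
      apply div_neg_of_neg_of_pos
      · have : 0 < (A.re ^ 2 + A.im ^ 2) * (C.re + 2) := by positivity
        linarith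
      · positivity
    linarith
  have hr : A.re = 0 := by nlinarith [sq_nonneg A.re, sq_nonneg A.im]
  have hi : A.im = 0 := by nlinarith [sq_nonneg A.re, sq_nonneg A.im]
  exact ⟨Complex.ext hr hi, Complex.ext (by simp [hBr, hr]) (by simp [hBi, hi])⟩

lemma eq_vectorState {ω : WeakDual ℂ M2} (hω : ω ∈ stateSpace) {e : H2} (he : ‖e‖ = 1)
    (h0 : ω (1 - ketbra e) = 0) : ω = vectorState e := by
  have hp : star (ketbra e) = ketbra e := (ketbra_posSemidef e).1
  have hpp := ketbra_idem he
  have hq : star (1 - ketbra e) = 1 - ketbra e := by rw [star_sub, star_one, hp]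
  have hqq : (1 - ketbra e) * (1 - ketbra e) = 1 - ketbra e := by
    rw [mul_sub, sub_mul, sub_mul, hpp]; simp
  have h1 : ω (ketbra e) = 1 := by
    rw [map_sub, hω.2] at h0
    exact (sub_eq_zero.mp h0).symm
  apply DFunLike.ext
  intro x
  have a1 := (state_null hω hq hqq h0 x).1
  have a2 := (state_null hω hq hqq h0 (star (ketbra e * x))).2
  rw [star_star] at a2
  have e1 : x = (1 - ketbra e) * x + (ketbra e * x) * (1 - ketbra e)
      + ketbra e * x * ketbra e := by
    rw [mul_sub, sub_mul]; simp
  conv_lhs => rw [e1]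
  rw [map_add, map_add, a1, a2, ketbra_mul_mul, map_smul, h1]
  simp

lemma vectorState_mem_extremePoints {e : H2} (he : ‖e‖ = 1) :
    vectorState e ∈ Set.extremePoints ℝ stateSpace := by
  refine ⟨vectorState_mem_stateSpace he, ?_⟩
  rintro ω₁ h₁ ω₂ h₂ ⟨a, b, ha, hb, hab, h⟩
  have hp : star (ketbra e) = ketbra e := (ketbra_posSemidef e).1
  have hpp := ketbra_idem he
  have hpos : (0 : M2) ≤ 1 - ketbra e := by
    have hq : star (1 - ketbra e) * (1 - ketbra e) = 1 - ketbra e := by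
      rw [star_sub, star_one, hp, mul_sub, sub_mul, sub_mul, hpp]; simp
    rw [← hq]
    exact star_mul_self_nonneg _
  have hv : vectorState e (1 - ketbra e) = 0 := by
    rw [vectorState, densityState_apply, mul_sub, mul_one, hpp, sub_self, Matrix.trace_zero]
  have hs : (a : ℂ) * ω₁ (1 - ketbra e) + (b : ℂ) * ω₂ (1 - ketbra e) = 0 := by
    rw [← hv, ← h]
    rfl
  have n₁ := h₁.1 _ hpos
  have n₂ := h₂.1 _ hpos
  have z₁ : ω₁ (1 - ketbra e) = 0 := by
    obtain ⟨r₁, i₁⟩ := Complex.nonneg_iff.mp n₁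
    obtain ⟨r₂, i₂⟩ := Complex.nonneg_iff.mp n₂
    have hre := congrArg Complex.re hs
    simp only [Complex.add_re, Complex.re_ofReal_mul, Complex.zero_re] at hre
    have : (ω₁ (1 - ketbra e)).re = 0 := by
      have p₁ := mul_nonneg ha.le r₁
      have p₂ := mul_nonneg hb.le r₂
      have : a * (ω₁ (1 - ketbra e)).re = 0 := by linarith
      rcases mul_eq_zero.mp this with h' | h'
      · exact absurd h' ha.ne'
      · exact h'
    exact Complex.ext this i₁.symm
  exact eq_vectorState h₁ he z₁

/-- The pure state space `P` of `M_2`: the extreme points of the state space, with the weak-*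
topology and its Borel sets. -/
def PureState : Type := {ω : WeakDual ℂ M2 // ω ∈ Set.extremePoints ℝ stateSpace}

instance : TopologicalSpace PureState :=
  inferInstanceAs (TopologicalSpace {ω : WeakDual ℂ M2 // ω ∈ Set.extremePoints ℝ stateSpace})

instance : MeasurableSpace PureState := borel PureState

instance : BorelSpace PureState := ⟨rfl⟩

/-- The pure state `ω_{|e⟩⟨e|}` of a unit vector `e`. -/
noncomputable def pureState (e : H2) (he : ‖e‖ = 1) : PureState :=
  ⟨vectorState e, vectorState_mem_extremePoints he⟩

/-- `μ` is an orthogonal measure representing `ω`: it is `∑ aᵢ δ_{ω_{|eᵢ⟩⟨eᵢ|}}` for a diagonal form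
`∑ aᵢ |eᵢ⟩⟨eᵢ|`, with `(eᵢ)` an orthonormal basis, of the density matrix of `ω`. -/
def IsOrthogonalMeasure (ω : WeakDual ℂ M2) (μ : Measure PureState) : Prop :=
  ∃ (e : OrthonormalBasis (Fin 2) ℂ H2) (a : Fin 2 → ℝ≥0),
    ω = densityState (∑ i, ((a i : ℝ) : ℂ) • ketbra (e i)) ∧
    μ = ∑ i, (a i : ℝ≥0∞) • Measure.dirac (pureState (e i) (e.norm_eq_one i))

/-! ### Quantum Markov semigroups -/

/-- `(T_t)_{t ≥ 0}` is a w*-continuous one-parameter semigroup of identity preserving (completely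
positive, linear) maps of `M_2`. -/
structure IsQuantumMarkovSemigroup (T : ℝ≥0 → (M2 →CP M2)) : Prop where
  zero : ∀ x, T 0 x = x
  add : ∀ s t x, T (s + t) x = T s (T t x)
  unital : ∀ t, T t 1 = 1
  weakStarContinuous : ∀ (ω : WeakDual ℂ M2) (x : M2), Continuous fun t => ω (T t x)

/-- The predual map `T_*` on functionals: `T_*(ω) = ω ∘ T`. -/
noncomputable def predual (φ : M2 →CP M2) (ω : WeakDual ℂ M2) : WeakDual ℂ M2 :=
  StrongDual.toWeakDual (LinearMap.toContinuousLinearMap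
    ((WeakDual.toStrongDual ω).toLinearMap ∘ₗ φ.toLinearMap))

lemma predual_apply (φ : M2 →CP M2) (ω : WeakDual ℂ M2) (x : M2) :
    predual φ ω x = ω (φ x) := rfl

/-- The predual map on matrices, `ρ ↦ T̃_*(ρ)`; it is determined by `predual_densityState` below. -/
noncomputable def predualMatrix (φ : M2 →CP M2) (ρ : M2) : M2 :=
  Matrix.of fun i j => (ρ * φ (Matrix.single j i 1)).trace

lemma predual_densityState (φ : M2 →CP M2) (ρ : M2) :
    densityState (predualMatrix φ ρ) = predual φ (densityState ρ) := by
  apply DFunLike.ext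
  intro x
  rw [predual_apply, densityState_apply, densityState_apply]
  conv_rhs => rw [Matrix.matrix_eq_sum_single x]
  have hs : ∀ i j : Fin 2, Matrix.single i j (x i j) = x i j • Matrix.single i j (1 : ℂ) := by
    intro i j; rw [Matrix.smul_single]; simp
  simp only [hs, map_sum, map_smul, Finset.mul_sum, Matrix.trace_sum, mul_smul_comm,
    Matrix.trace_smul]
  simp only [Matrix.trace, Matrix.diag, Matrix.mul_apply, predualMatrix, Matrix.of_apply,
    Fin.sum_univ_two, smul_eq_mul]
  ring

/-- `ω_∞` is absorbing: it is a state, and `T_{*t}(ω) → ω_∞` weak-* for every state `ω`. -/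
def IsAbsorbing (T : ℝ≥0 → (M2 →CP M2)) (ω_infty : WeakDual ℂ M2) : Prop :=
  ω_infty ∈ stateSpace ∧
    ∀ ω ∈ stateSpace, Tendsto (fun t => predual (T t) ω) atTop (𝓝 ω_infty)

/-- `L` is the generator of the semigroup `(T̃_{*t})` on `M_2`. -/
def IsPredualGenerator (T : ℝ≥0 → (M2 →CP M2)) (L : M2 → M2) : Prop :=
  ∀ ρ : M2, Tendsto (fun t : ℝ≥0 => (t : ℝ)⁻¹ • (predualMatrix (T t) ρ - ρ)) (𝓝[>] 0) (𝓝 (L ρ))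

/-- `y, z₁, z₂` are parameters of the generator of `(T̃_{*t})`, adapted to the vector `e`: the
generator is `ρ ↦ y ρ + ρ y* + ∑ᵢ zᵢ ρ zᵢ*`, and `y e = y* e = z₁ e = z₂ e = 0`. -/
structure IsGeneratorParameters (T : ℝ≥0 → (M2 →CP M2)) (e : H2) (y z₁ z₂ : M2) : Prop where
  generator : IsPredualGenerator T
    fun ρ => y * ρ + ρ * yᴴ + (z₁ * ρ * z₁ᴴ + z₂ * ρ * z₂ᴴ)
  y_apply : act y e = 0
  y_adjoint_apply : act yᴴ e = 0
  z₁_apply : act z₁ e = 0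
  z₂_apply : act z₂ e = 0

/-- The real eigenvalues of a matrix (all the eigenvalues, if it is self-adjoint). -/
def realEigenvalues (x : M2) : Set ℝ :=
  {r | Module.End.HasEigenvalue (Matrix.toEuclideanLin x) (r : ℂ)}

/-! ### Large deviations -/

/-- The net `(μ_t)` of Borel probability measures satisfies a large deviation principle with powers
`1/t` and rate function `J`. -/
structure LargeDeviationPrinciple {X : Type*} [TopologicalSpace X] [MeasurableSpace X]
    (μ : ℝ≥0 → Measure X) (J : X → ℝ≥0∞) : Prop where
  probability : ∀ t, IsProbabilityMeasure (μ t)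
  lowerSemicontinuous : LowerSemicontinuous J
  upper : ∀ F : Set X, IsClosed F →
    limsup (fun t : ℝ≥0 => μ t F ^ (1 / (t : ℝ))) atTop ≤ ⨆ x ∈ F, EReal.exp (-(J x : EReal))
  lower : ∀ G : Set X, IsOpen G →
    ⨆ x ∈ G, EReal.exp (-(J x : EReal)) ≤ liminf (fun t : ℝ≥0 => μ t G ^ (1 / (t : ℝ))) atTop

open Classical in
/-- The function on `P` with value `0` at `ω_{|e₁⟩⟨e₁|}`, `c` at `ω_{|e₂⟩⟨e₂|}`, `+∞` elsewhere. -/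
noncomputable def rateFunction (e₁ e₂ : H2) (c : ℝ≥0∞) (ω : PureState) : ℝ≥0∞ :=
  if ω.1 = vectorState e₁ then 0 else if ω.1 = vectorState e₂ then c else ⊤

end QMS

namespace QMS

/-! In the basis `(e₁, e₂)` each predual map preserves the trace and, by absorption, fixes
`|e₁⟩⟨e₁|`. This leaves only three parameters: the map is `channelForm r w q`, where `q` is the
factor on the `e₂`-population and `r` the factor on the coherence (`exists_channelForm`). Both are
multiplicative in `t`, so `q t = exp (c t)`. The diagonal entries of the generator give `c = a - η`
(`IsGeneratorParameters.tendsto_q`), and absorption of `e₂` forces `c < 0`.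

The least eigenvalue of the evolved state `ρ_t` is at most `⟨e₂, ρ_t e₂⟩ = q t * ⟨e₂, ρ e₂⟩`. For
the matching lower bound `ρ_t ≥ C q t`, the image of the identity dominates a multiple of `q t`
(`channelForm_one_sub_posSemidef`), so it is enough that `ρ_t` is invertible at one time. A singular
image imposes an algebraic identity on `ρ` and the channel, and this identity cannot hold at both
`t` and `2t` (`exists_posDef`).

So the smaller weight of every orthogonal measure is of exact order `exp ((a - η) t)`. Since it
tends to zero, the dominant eigenprojection tends to `|e₁⟩⟨e₁|` and its complement to `|e₂⟩⟨e₂|`.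
What remains is a large deviation principle for two converging atoms, one of exponentially small
mass (`largeDeviationPrinciple_two_atoms`). -/

/-! ### Kraus operators and the predual semigroup. -/

lemma exists_eq_star_mul_self {A : Type*} [NonUnitalCStarAlgebra A] [PartialOrder A]
    [StarOrderedRing A] {a : A} (ha : 0 ≤ a) : ∃ b, a = star b * b :=
  CStarAlgebra.nonneg_iff_eq_star_mul_self.mp ha

/-- Kraus decomposition of a completely positive map of `M_2`. -/
lemma exists_kraus (φ : M2 →CP M2) :
    ∃ K : Fin 2 × Fin 2 → M2, ∀ x, φ x = ∑ k, (K k)ᴴ * x * K k := by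
  -- Choi's argument: the block matrix of matrix units is `star R * R`, where `R` has first row
  -- `E_{0j}` and zeros below. Its image under the amplification of `φ` is therefore positive, and
  -- the blocks of a factor `B` of that image, cut into rows, are the Kraus operators.
  set M : CStarMatrix (Fin 2) (Fin 2) M2 :=
    CStarMatrix.ofMatrix (Matrix.of fun i j => Matrix.single i j (1 : ℂ)) with hM
  have hpos : 0 ≤ M := by
    have h : M = star (CStarMatrix.ofMatrix (Matrix.of fun i j : Fin 2 =>
        if i = 0 then Matrix.single (0 : Fin 2) j (1 : ℂ) else 0)) *
        (CStarMatrix.ofMatrix (Matrix.of fun i j : Fin 2 =>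
        if i = 0 then Matrix.single (0 : Fin 2) j (1 : ℂ) else 0)) := by
      apply CStarMatrix.ext
      intro i j
      rw [CStarMatrix.mul_apply]
      simp [hM, CStarMatrix.star_apply, Matrix.star_eq_conjTranspose]
    rw [h]
    exact star_mul_self_nonneg _
  obtain ⟨B, hB⟩ := exists_eq_star_mul_self (φ.map_cstarMatrix_nonneg M hpos)
  have hentry : ∀ i j, φ (Matrix.single i j 1) = ∑ k, (B k i)ᴴ * B k j := by
    intro i j
    have := congrArg (fun N : CStarMatrix (Fin 2) (Fin 2) M2 => N i j) hB
    simp only [CStarMatrix.map_apply, CStarMatrix.mul_apply, CStarMatrix.star_apply] at this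
    exact this
  refine ⟨fun k => Matrix.of fun j n => B k.1 j k.2 n, fun x => ?_⟩
  have hx : φ x = ∑ i, ∑ j, x i j • φ (Matrix.single i j 1) := by
    conv_lhs => rw [Matrix.matrix_eq_sum_single x]
    simp only [map_sum, ← map_smul, Matrix.smul_single, smul_eq_mul, mul_one]
  rw [hx]
  simp only [hentry]
  ext p n
  simp only [Fin.sum_univ_two, Fintype.sum_prod_type, Matrix.add_apply, Matrix.smul_apply,
    Matrix.mul_apply, Matrix.conjTranspose_apply, Matrix.of_apply, smul_eq_mul]
  ring

lemma predualMatrix_kraus {φ : M2 →CP M2} {ι : Type*} [Fintype ι] {K : ι → M2}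
    (hK : ∀ x, φ x = ∑ k, (K k)ᴴ * x * K k) (ρ : M2) :
    predualMatrix φ ρ = ∑ k, K k * ρ * (K k)ᴴ := by
  ext i j
  simp only [predualMatrix, Matrix.of_apply, hK, Finset.mul_sum, Matrix.trace_sum, Matrix.sum_apply]
  refine Finset.sum_congr rfl fun k _ => ?_
  rw [← mul_assoc, Matrix.trace_mul_comm]
  simp only [← mul_assoc]
  rw [Matrix.trace_mul_comm, Matrix.trace_single_mul]
  simp

lemma trace_predualMatrix_mul (φ : M2 →CP M2) (ρ x : M2) :
    (predualMatrix φ ρ * x).trace = (ρ * φ x).trace := by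
  rw [← densityState_apply, predual_densityState]; rfl

/-- The predual map as a continuous linear map. -/
noncomputable def predualCLM (φ : M2 →CP M2) : M2 →L[ℂ] M2 :=
  LinearMap.toContinuousLinearMap
    { toFun := predualMatrix φ
      map_add' := fun a b => by ext i j; simp [predualMatrix, add_mul]
      map_smul' := fun c a => by ext i j; simp [predualMatrix] }

lemma eq_of_trace_mul_eq {a b : M2} (h : ∀ x : M2, (a * x).trace = (b * x).trace) : a = b := by
  ext i j
  simpa [Matrix.trace_mul_single] using h (Matrix.single j i 1)

namespace IsQuantumMarkovSemigroup

variable {T : ℝ≥0 → (M2 →CP M2)}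

lemma predualMatrix_zero (hT : IsQuantumMarkovSemigroup T) (ρ : M2) : predualMatrix (T 0) ρ = ρ :=
  eq_of_trace_mul_eq fun x => by rw [trace_predualMatrix_mul, hT.zero]

/-- Duality reverses the order of composition; commutativity of time restores it. -/
lemma predualMatrix_add (hT : IsQuantumMarkovSemigroup T) (s t : ℝ≥0) (ρ : M2) :
    predualMatrix (T (s + t)) ρ = predualMatrix (T s) (predualMatrix (T t) ρ) :=
  eq_of_trace_mul_eq fun x => by
    simp only [trace_predualMatrix_mul]; rw [add_comm, hT.add]

lemma trace_predualMatrix (hT : IsQuantumMarkovSemigroup T) (t : ℝ≥0) (ρ : M2) :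
    (predualMatrix (T t) ρ).trace = ρ.trace := by
  have := trace_predualMatrix_mul (T t) ρ 1
  rwa [hT.unital, mul_one, mul_one] at this

lemma continuous_predualMatrix (hT : IsQuantumMarkovSemigroup T) (ρ : M2) :
    Continuous fun t => predualMatrix (T t) ρ := by
  refine continuous_matrix fun i j => ?_
  exact hT.weakStarContinuous (densityState ρ) (Matrix.single j i 1)

end IsQuantumMarkovSemigroup

/-! ### Generators and exponentials. -/

lemma tendsto_coe_nhdsGT_zero :
    Tendsto ((↑) : ℝ≥0 → ℝ) (𝓝[>] 0) (𝓝[>] 0) := by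
  refine tendsto_nhdsWithin_iff.mpr ⟨?_, ?_⟩
  · exact (NNReal.continuous_coe.tendsto 0).mono_left nhdsWithin_le_nhds
  · filter_upwards [self_mem_nhdsWithin] with t ht
    exact NNReal.coe_pos.mpr ht

/-- A norm-continuous one-parameter semigroup in a Banach algebra has a generator. -/
lemma exists_generator_of_continuous {A : Type*} [NormedRing A] [NormedAlgebra ℝ A]
    [CompleteSpace A] {F : ℝ≥0 → A} (hF : Continuous F) (h0 : F 0 = 1)
    (hadd : ∀ s t, F (s + t) = F s * F t) :
    ∃ X : A, Tendsto (fun t : ℝ≥0 => (t : ℝ)⁻¹ • (F t - 1)) (𝓝[>] 0) (𝓝 X) := by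
  set G : ℝ → A := fun s => F s.toNNReal with hG
  have hGc : Continuous G := hF.comp continuous_real_toNNReal
  have hG0 : G 0 = 1 := by simp [hG, h0]
  set V : ℝ → A := fun s => ∫ u in (0 : ℝ)..s, G u with hV
  have hVd : ∀ s, HasDerivAt V (G s) s := fun s =>
    intervalIntegral.integral_hasDerivAt_right (hGc.intervalIntegrable _ _)
      (hGc.stronglyMeasurableAtFilter _ _) hGc.continuousAt
  have hV0 : V 0 = 0 := by simp [hV]
  -- The averages `δ⁻¹ V δ` tend to `1` and the units are open, so `V δ` is invertible for some
  -- small `δ`.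
  obtain ⟨δ, hδ, u, hu⟩ : ∃ δ : ℝ, 0 < δ ∧ IsUnit (V δ) := by
    have h1 : Tendsto (fun δ : ℝ => δ⁻¹ • V δ) (𝓝[>] 0) (𝓝 1) := by
      have := (hasDerivAt_iff_tendsto_slope_zero.mp (hVd 0)).mono_left
        (nhdsGT_le_nhdsNE 0)
      simpa [hV0, hG0] using this
    have h2 : ∀ᶠ δ : ℝ in 𝓝[>] 0, IsUnit (δ⁻¹ • V δ) :=
      h1.eventually (Units.isOpen.mem_nhds isUnit_one)
    obtain ⟨δ, hδu, hδ⟩ := (h2.and self_mem_nhdsWithin).exists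
    have hδ' : (0 : ℝ) < δ := hδ
    refine ⟨δ, hδ', ?_⟩
    have h3 := hδu.smul (Units.mk0 δ hδ'.ne')
    simpa [Units.smul_def, smul_smul, mul_inv_cancel₀ hδ'.ne'] using h3
  -- The right side is differentiable in `t`; dividing by the unit `V δ` makes `F` differentiable.
  have key : ∀ t : ℝ≥0, F t * V δ = V (t + δ) - V t := by
    intro t
    have h1 : ∀ s ∈ Set.uIcc (0 : ℝ) δ, F t * G s = G (t + s) := by
      intro s hs
      rw [Set.uIcc_of_le hδ.le] at hs
      simp only [hG]
      rw [Real.toNNReal_add t.coe_nonneg hs.1, hadd, Real.toNNReal_coe]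
    have h2 : F t * V δ = ∫ s in (0 : ℝ)..δ, F t * G s := by
      simp only [hV]
      exact (((ContinuousLinearMap.mul ℝ A) (F t)).intervalIntegral_comp_comm
        (hGc.intervalIntegrable _ _)).symm
    rw [h2, intervalIntegral.integral_congr h1, intervalIntegral.integral_comp_add_left]
    simp only [hV, add_zero]
    rw [intervalIntegral.integral_interval_sub_left (hGc.intervalIntegrable _ _)
      (hGc.intervalIntegrable _ _)]
  set H : ℝ → A := fun t => (V (t + δ) - V t) * ↑u⁻¹ with hH
  have hFH : ∀ t : ℝ≥0, F t = H t := by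
    intro t
    simp only [hH, ← key, ← hu, mul_assoc, Units.mul_inv, mul_one]
  have hHd : HasDerivAt H ((G (0 + δ) - G 0) * ↑u⁻¹) 0 :=
    (((hVd (0 + δ)).comp_add_const 0 δ).sub (hVd 0)).mul_const _
  refine ⟨_, (((hasDerivAt_iff_tendsto_slope_zero.mp hHd).mono_left
    (nhdsGT_le_nhdsNE 0)).comp tendsto_coe_nhdsGT_zero).congr
      fun t => ?_⟩
  have : H 0 = 1 := by rw [← h0, hFH 0, NNReal.coe_zero]
  simp [hFH t, this]

/-- A continuous multiplicative function on `[0, ∞)` is the exponential given by its derivative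
at zero. -/
lemma eq_exp_of_mul {q : ℝ≥0 → ℝ} (hq : Continuous q) (h0 : q 0 = 1)
    (hadd : ∀ s t, q (s + t) = q s * q t) {c : ℝ}
    (hc : Tendsto (fun t : ℝ≥0 => (t : ℝ)⁻¹ * (q t - 1)) (𝓝[>] 0) (𝓝 c)) (t : ℝ≥0) :
    q t = Real.exp (c * t) := by
  set g : ℝ → ℝ := fun s => q s.toNNReal with hg
  have hgc : Continuous g := hq.comp continuous_real_toNNReal
  have hg0 : g 0 = 1 := by simp [hg, h0]
  have hd0 : HasDerivWithinAt g c (Set.Ici 0) 0 := by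
    rw [← hasDerivWithinAt_Ioi_iff_Ici, hasDerivWithinAt_iff_tendsto_slope' (by simp)]
    have h1 : Tendsto Real.toNNReal (𝓝[>] 0) (𝓝[>] 0) := by
      refine tendsto_nhdsWithin_iff.mpr ⟨?_, ?_⟩
      · have := continuous_real_toNNReal.tendsto 0
        rw [Real.toNNReal_zero] at this
        exact this.mono_left nhdsWithin_le_nhds
      · filter_upwards [self_mem_nhdsWithin] with t ht
        exact Real.toNNReal_pos.mpr ht
    refine (hc.comp h1).congr' ?_
    filter_upwards [self_mem_nhdsWithin] with s hs
    have hs' : (0 : ℝ) < s := hs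
    simp [slope_def_field, Real.coe_toNNReal s hs'.le, hg, h0]
    field_simp
  -- Multiplicativity carries the right derivative from `0` to `x`; right derivatives are enough to
  -- show that `g s * exp (-(c s))` is constant.
  have hd : ∀ x ∈ Set.Ico (0 : ℝ) t, HasDerivWithinAt g (g x * c) (Set.Ici x) x := by
    intro x hx
    have h1 : HasDerivWithinAt (fun s : ℝ => s - x) 1 (Set.Ici x) x :=
      (hasDerivWithinAt_id x _).sub_const x
    have h2 : HasDerivWithinAt (fun s => g x * g (s - x)) (g x * (c * 1)) (Set.Ici x) x := by
      refine HasDerivWithinAt.const_mul _ ?_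
      have h3 : HasDerivWithinAt g c (Set.Ici 0) (x - x) := by rwa [sub_self]
      exact HasDerivWithinAt.comp (h₂ := g) (h := fun s => s - x) x h3 h1
        (fun s (hs : x ≤ s) => sub_nonneg.mpr hs)
    rw [mul_one] at h2
    refine h2.congr (fun s (hs : x ≤ s) => ?_) (by simp [hg0])
    simp only [hg]
    rw [← hadd, ← Real.toNNReal_add hx.1 (sub_nonneg.mpr hs)]
    congr 2; ring
  have hconst := constant_of_has_deriv_right_zero (f := fun s => g s * Real.exp (-(c * s)))
    (a := 0) (b := t) (by fun_prop) (fun x hx => by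
      have he : HasDerivWithinAt (fun s : ℝ => Real.exp (-(c * s)))
          (Real.exp (-(c * x)) * -(c * 1)) (Set.Ici x) x :=
        (((hasDerivAt_id x).const_mul c).neg.exp).hasDerivWithinAt
      have h := (hd x hx).mul he
      have hz : g x * c * Real.exp (-(c * x)) + g x * (Real.exp (-(c * x)) * -(c * 1)) = 0 := by
        ring
      rwa [hz] at h) t ⟨t.coe_nonneg, le_rfl⟩
  simp only [hg0, mul_zero, neg_zero, Real.exp_zero, mul_one] at hconst
  have hgt : g t = q t := by simp [hg]
  rw [← hgt, ← mul_one (g t), ← Real.exp_zero, ← neg_add_cancel (c * (t : ℝ)), Real.exp_add,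
    ← mul_assoc, hconst, one_mul]

/-! ### Hermitian forms in two variables. -/

/-- The quadratic form of the Hermitian matrix `!![α, g; conj g, β]`. -/
noncomputable def quadForm (α β : ℝ) (g : ℂ) (v w : ℂ) : ℝ :=
  α * Complex.normSq v + 2 * (star v * g * w).re + β * Complex.normSq w

/-- The Hermitian matrix with diagonal entries `α, β` and upper off-diagonal entry `g`. -/
def hermMatrix (α β : ℝ) (g : ℂ) : M2 := !![(α : ℂ), g; star g, (β : ℂ)]

lemma hermMatrix_form (α β : ℝ) (g : ℂ) (v : Fin 2 → ℂ) :
    star v ⬝ᵥ (hermMatrix α β g *ᵥ v) = (quadForm α β g (v 0) (v 1) : ℂ) := by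
  apply Complex.ext <;>
    simp [hermMatrix, quadForm, Matrix.mulVec, dotProduct, Fin.sum_univ_two,
      Complex.normSq_apply] <;> ring

lemma hermMatrix_posSemidef_iff {α β : ℝ} {g : ℂ} :
    (hermMatrix α β g).PosSemidef ↔ ∀ v w, 0 ≤ quadForm α β g v w := by
  rw [Matrix.posSemidef_iff_dotProduct_mulVec]
  constructor
  · rintro ⟨-, h⟩ v w
    have := h ![v, w]
    rw [hermMatrix_form] at this
    simpa using this
  · intro h
    refine ⟨?_, fun v => ?_⟩
    · ext i j
      fin_cases i <;> fin_cases j <;> simp [hermMatrix]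
    · rw [hermMatrix_form]
      exact_mod_cast h _ _

lemma eq_hermMatrix {ρ : M2} (h : ρ.IsHermitian) :
    ρ = hermMatrix (ρ 0 0).re (ρ 1 1).re (ρ 0 1) := by
  have h00 := h.apply 0 0
  have h11 := h.apply 1 1
  have h10 := h.apply 1 0
  ext i j
  fin_cases i <;> fin_cases j <;> simp [hermMatrix]
  · exact (Complex.conj_eq_iff_re.mp h00).symm
  · exact h10.symm
  · exact (Complex.conj_eq_iff_re.mp h11).symm

/-- The diagonal parts of a nonnegative form balance at its zeros. -/
lemma quadForm_balance {α β : ℝ} {g : ℂ} (h : ∀ v w, 0 ≤ quadForm α β g v w) {v w : ℂ}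
    (h0 : quadForm α β g v w = 0) : α * Complex.normSq v = β * Complex.normSq w := by
  set A := α * Complex.normSq v with hA
  set B := β * Complex.normSq w with hB
  set C := 2 * (star v * g * w).re with hC
  have hsum : A + C + B = 0 := h0
  -- Rescaling `v` gives a nonnegative quadratic in `l` that vanishes at `l = 1`. If `A ≠ B` it is
  -- negative at its vertex `(A + B) / (2 * A)`, or at `2` when `A = 0`.
  have hl : ∀ l : ℝ, 0 ≤ A * l ^ 2 + C * l + B := by
    intro l
    have := h (l * v) w
    have e : quadForm α β g (l * v) w = A * l ^ 2 + C * l + B := by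
      simp [quadForm, hA, hB, hC]; ring
    rwa [e] at this
  have hA0 : 0 ≤ A := mul_nonneg (by simpa [quadForm] using h 1 0) (Complex.normSq_nonneg v)
  have hB0 : 0 ≤ B := mul_nonneg (by simpa [quadForm] using h 0 1) (Complex.normSq_nonneg w)
  by_contra hne
  have hAB : 0 < A + B := by
    rcases hA0.lt_or_eq with h1 | h1
    · linarith
    · rcases hB0.lt_or_eq with h2 | h2
      · linarith
      · exact absurd (h1.symm.trans h2) hne
  have hC' : C = -(A + B) := by linarith
  by_cases hAz : A = 0
  · have := hl 2
    rw [hC', hAz] at this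
    have : 0 < B := by linarith
    linarith
  · have hApos : 0 < A := lt_of_le_of_ne hA0 (Ne.symm hAz)
    have := hl ((A + B) / (2 * A))
    have e : A * ((A + B) / (2 * A)) ^ 2 + C * ((A + B) / (2 * A)) + B
        = -(A - B) ^ 2 / (4 * A) := by
      rw [hC']; field_simp; ring
    rw [e] at this
    have : 0 < (A - B) ^ 2 := by
      have : A - B ≠ 0 := sub_ne_zero.mpr hne
      positivity
    have : -(A - B) ^ 2 / (4 * A) < 0 := div_neg_of_neg_of_pos (by linarith) (by linarith)
    linarith

/-! ### Channels that fix the first basis state. -/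

/-- The general form of a channel of `M_2` that fixes the first basis state. -/
noncomputable def channelForm (r w : ℂ) (q : ℝ) (ρ : M2) : M2 :=
  !![ρ 0 0 + (1 - q) * ρ 1 1, r * ρ 0 1 + w * ρ 1 1;
    star r * ρ 1 0 + star w * ρ 1 1, q * ρ 1 1]

/-- Fixing `E_{00}` kills every lower left Kraus entry, and trace preservation then makes the vector
`(V k 0 0)` a unit vector orthogonal to `(V k 0 1)`. The remaining Gram entries are `r`, `w` and
`q`. -/
lemma exists_channelForm {ι : Type*} [Fintype ι] {V : ι → M2}
    (htr : ∀ ρ : M2, (∑ k, V k * ρ * (V k)ᴴ).trace = ρ.trace)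
    (h0 : ∑ k, V k * Matrix.single 0 0 1 * (V k)ᴴ = Matrix.single 0 0 1) :
    ∃ (r w : ℂ) (q : ℝ), (∀ ρ, ∑ k, V k * ρ * (V k)ᴴ = channelForm r w q ρ) ∧
      ∀ v₁ v₂, 0 ≤ quadForm (1 - q) (q - Complex.normSq r) w v₁ v₂ := by
  have hentry : ∀ (ρ : M2) (i j : Fin 2), (∑ k, V k * ρ * (V k)ᴴ) i j =
      ∑ k, (V k i 0 * ρ 0 0 * star (V k j 0) + V k i 0 * ρ 0 1 * star (V k j 1) +
        V k i 1 * ρ 1 0 * star (V k j 0) + V k i 1 * ρ 1 1 * star (V k j 1)) := by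
    intro ρ i j
    rw [Matrix.sum_apply]
    refine Finset.sum_congr rfl fun k _ => ?_
    simp only [Matrix.mul_apply, Fin.sum_univ_two, Matrix.conjTranspose_apply]
    ring
  have hV10 : ∀ k, V k 1 0 = 0 := by
    have h := congrFun (congrFun h0 1) 1
    rw [hentry] at h
    simp [Complex.mul_conj] at h
    have h' : ∑ k, Complex.normSq (V k 1 0) = 0 := by exact_mod_cast h
    rw [Finset.sum_eq_zero_iff_of_nonneg (fun k _ => Complex.normSq_nonneg _)] at h'
    exact fun k => Complex.normSq_eq_zero.mp (h' k (Finset.mem_univ k))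
  have h00 : ∑ k, V k 0 0 * star (V k 0 0) = 1 := by
    have h := congrFun (congrFun h0 0) 0
    rw [hentry] at h
    simpa using h
  have h01 : ∑ k, V k 0 0 * star (V k 0 1) = 0 := by
    have h := htr (Matrix.single 0 1 1)
    simp only [Matrix.trace, Matrix.diag, Fin.sum_univ_two, hentry] at h
    simpa [hV10] using h
  have h10 : ∑ k, V k 0 1 * star (V k 0 0) = 0 := by
    simpa [mul_comm] using congrArg star h01
  have h11 : ∑ k, V k 0 1 * star (V k 0 1) = 1 - ∑ k, V k 1 1 * star (V k 1 1) := by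
    have h := htr (Matrix.single 1 1 1)
    simp only [Matrix.trace, Matrix.diag, Fin.sum_univ_two, hentry] at h
    rw [eq_sub_iff_add_eq]
    simpa [hV10] using h
  set r := ∑ k, V k 0 0 * star (V k 1 1) with hr
  set w := ∑ k, V k 0 1 * star (V k 1 1) with hw
  set q := ∑ k, Complex.normSq (V k 1 1) with hq
  have hqc : ∑ k, V k 1 1 * star (V k 1 1) = (q : ℂ) := by simp [hq, Complex.mul_conj]
  have hr' : ∑ k, V k 1 1 * star (V k 0 0) = star r := by simp [hr, mul_comm]
  have hw' : ∑ k, V k 1 1 * star (V k 0 1) = star w := by simp [hw, mul_comm]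
  have hpull : ∀ (f g : ι → ℂ) (c : ℂ),
      ∑ k, f k * c * star (g k) = (∑ k, f k * star (g k)) * c := by
    intro f g c
    rw [Finset.sum_mul]
    exact Finset.sum_congr rfl fun k _ => by ring
  refine ⟨r, w, q, fun ρ => ?_, fun v₁ v₂ => ?_⟩
  · ext i j
    rw [hentry]
    simp only [Finset.sum_add_distrib]
    rw [hpull (fun k => V k i 0) (fun k => V k j 0), hpull (fun k => V k i 0) (fun k => V k j 1),
      hpull (fun k => V k i 1) (fun k => V k j 0), hpull (fun k => V k i 1) (fun k => V k j 1)]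
    fin_cases i <;> fin_cases j <;>
      simp only [Fin.zero_eta, Fin.mk_one, hV10, h00, h01, h10, h11, hqc, hr', hw', ← hr, ← hw,
        channelForm, star_zero, mul_zero, zero_mul, Finset.sum_const_zero, Matrix.of_apply,
        Matrix.cons_val', Matrix.cons_val_zero, Matrix.cons_val_one, Matrix.cons_val_fin_one] <;>
      ring
  -- The form is a squared norm: it is the Gram form of `(V k 0 1)` and of `(V k 1 1)` with its
  -- component along `(V k 0 0)` removed.
  · have key : ∑ k, (star v₁ * V k 0 1 + star v₂ * V k 1 1 - star v₂ * star r * V k 0 0) *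
        star (star v₁ * V k 0 1 + star v₂ * V k 1 1 - star v₂ * star r * V k 0 0) =
        (quadForm (1 - q) (q - Complex.normSq r) w v₁ v₂ : ℂ) := by
      have e : ∀ k, (star v₁ * V k 0 1 + star v₂ * V k 1 1 - star v₂ * star r * V k 0 0) *
        star (star v₁ * V k 0 1 + star v₂ * V k 1 1 - star v₂ * star r * V k 0 0) =
        (V k 0 1 * star (V k 0 1)) * (star v₁ * v₁) + (V k 0 1 * star (V k 1 1)) * (star v₁ * v₂)
        + (V k 1 1 * star (V k 0 1)) * (star v₂ * v₁)
        + (V k 1 1 * star (V k 1 1)) * (star v₂ * v₂)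
        - (V k 0 1 * star (V k 0 0)) * (star v₁ * v₂ * r)
        - (V k 0 0 * star (V k 0 1)) * (star v₂ * v₁ * star r)
        - (V k 1 1 * star (V k 0 0)) * (star v₂ * v₂ * r)
        - (V k 0 0 * star (V k 1 1)) * (star v₂ * v₂ * star r)
        + (V k 0 0 * star (V k 0 0)) * (star v₂ * v₂ * r * star r) := by
        intro k
        simp only [star_sub, star_add, star_mul', star_star]
        ring
      simp only [e, Finset.sum_add_distrib, Finset.sum_sub_distrib, ← Finset.sum_mul, h00, h01,
        h10, h11, hqc, hr', hw', ← hr, ← hw]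
      apply Complex.ext <;> simp [quadForm, Complex.normSq_apply] <;> ring
    have : (0 : ℂ) ≤ (quadForm (1 - q) (q - Complex.normSq r) w v₁ v₂ : ℂ) := by
      rw [← key]
      exact Finset.sum_nonneg fun k _ => mul_star_self_nonneg _
    exact_mod_cast this

lemma channelForm_hermMatrix (r w : ℂ) (q α β : ℝ) (g : ℂ) :
    channelForm r w q (hermMatrix α β g) =
      hermMatrix (α + (1 - q) * β) (q * β) (r * g + w * β) := by
  ext i j
  fin_cases i <;> fin_cases j <;> simp [hermMatrix, channelForm]

/-- Splits the output form into two nonnegative pieces, the rescaled input form and the noise of the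
channel, so that the output vanishes only where both do. -/
lemma quadForm_channel (r w : ℂ) (q α β : ℝ) (g v₁ v₂ : ℂ) :
    quadForm (α + (1 - q) * β) (q * β) (r * g + w * β) v₁ v₂ =
      quadForm α β g v₁ (r * v₂) + β * quadForm (1 - q) (q - Complex.normSq r) w v₁ v₂ := by
  simp [quadForm, Complex.normSq_apply]; ring

lemma channelForm_add (r w : ℂ) (q : ℝ) (ρ σ : M2) :
    channelForm r w q (ρ + σ) = channelForm r w q ρ + channelForm r w q σ := by
  ext i j
  fin_cases i <;> fin_cases j <;> simp [channelForm] <;> ring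

lemma channelForm_smul (r w : ℂ) (q : ℝ) (c : ℂ) (ρ : M2) :
    channelForm r w q (c • ρ) = c • channelForm r w q ρ := by
  ext i j
  fin_cases i <;> fin_cases j <;> simp [channelForm] <;> ring

lemma hermMatrix_one : (1 : M2) = hermMatrix 1 1 0 := by
  ext i j
  fin_cases i <;> fin_cases j <;> simp [hermMatrix]

lemma hermMatrix_sub_smul_one (α β c : ℝ) (g : ℂ) :
    hermMatrix α β g - (c : ℂ) • (1 : M2) = hermMatrix (α - c) (β - c) g := by
  ext i j
  fin_cases i <;> fin_cases j <;> simp [hermMatrix]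

section

variable {r w : ℂ} {q : ℝ}

lemma one_sub_nonneg_of_form
    (h : ∀ v₁ v₂, 0 ≤ quadForm (1 - q) (q - Complex.normSq r) w v₁ v₂) :
    q ≤ 1 ∧ Complex.normSq r ≤ q := by
  have h1 := h 1 0
  have h2 := h 0 1
  simp [quadForm] at h1 h2
  exact ⟨h1, h2⟩

lemma channelForm_posSemidef
    (h : ∀ v₁ v₂, 0 ≤ quadForm (1 - q) (q - Complex.normSq r) w v₁ v₂) {ρ : M2}
    (hρ : ρ.PosSemidef) : (channelForm r w q ρ).PosSemidef := by
  obtain ⟨α, β, g, rfl⟩ : ∃ α β g, ρ = hermMatrix α β g := ⟨_, _, _, eq_hermMatrix hρ.1⟩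
  rw [hermMatrix_posSemidef_iff] at hρ
  rw [channelForm_hermMatrix, hermMatrix_posSemidef_iff]
  intro v₁ v₂
  rw [quadForm_channel]
  have hβ := hρ 0 1
  simp only [quadForm] at hβ
  simp at hβ
  exact add_nonneg (hρ _ _) (mul_nonneg hβ (h _ _))

lemma channelForm_one_sub_posSemidef
    (h : ∀ v₁ v₂, 0 ≤ quadForm (1 - q) (q - Complex.normSq r) w v₁ v₂) :
    (channelForm r w q 1 - ((2 / 9 * q : ℝ) : ℂ) • (1 : M2)).PosSemidef := by
  rw [hermMatrix_one, channelForm_hermMatrix, ← hermMatrix_one, hermMatrix_sub_smul_one,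
    hermMatrix_posSemidef_iff]
  intro v₁ v₂
  obtain ⟨h1, h2⟩ := one_sub_nonneg_of_form h
  have hr0 := Complex.normSq_nonneg r
  -- Reciprocal scalings leave the cross term unchanged. The share of `|v₂|²` drops to `9 / 16` of
  -- `q - |r|²`, which leaves room for `2 / 9 * q`; that of `|v₁|²` grows to `16 / 9 * (1 - q)`,
  -- which the diagonal entry `2 - q` absorbs.
  have hf := h ((4 / 3 : ℝ) * v₁) ((3 / 4 : ℝ) * v₂)
  have e : quadForm (1 - q) (q - Complex.normSq r) w ((4 / 3 : ℝ) * v₁) ((3 / 4 : ℝ) * v₂) =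
      16 / 9 * (1 - q) * Complex.normSq v₁ + 2 * (star v₁ * w * v₂).re
        + 9 / 16 * (q - Complex.normSq r) * Complex.normSq v₂ := by
    simp [quadForm, Complex.normSq_apply]; ring
  rw [e] at hf
  have e2 : quadForm (1 + (1 - q) * 1 - 2 / 9 * q) (q * 1 - 2 / 9 * q) (r * 0 + w * (1 : ℝ)) v₁ v₂ =
      (2 - q - 2 / 9 * q) * Complex.normSq v₁ + 2 * (star v₁ * w * v₂).re
        + (7 / 9 * q) * Complex.normSq v₂ := by
    simp [quadForm]; ring
  rw [e2]
  have p1 := mul_nonneg (by linarith : (0 : ℝ) ≤ (2 - q - 2 / 9 * q) - 16 / 9 * (1 - q))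
    (Complex.normSq_nonneg v₁)
  have p2 := mul_nonneg (by linarith : (0 : ℝ) ≤ (7 / 9 * q) - 9 / 16 * (q - Complex.normSq r))
    (Complex.normSq_nonneg v₂)
  nlinarith

/-- If the image of a density matrix is singular, its parameters are in special position. -/
lemma balance_of_not_posDef
    (h : ∀ v₁ v₂, 0 ≤ quadForm (1 - q) (q - Complex.normSq r) w v₁ v₂) {α β : ℝ} {g : ℂ}
    (hρ : ∀ v₁ v₂, 0 ≤ quadForm α β g v₁ v₂) (hβ : 0 < β) (hq : q < 1)
    (hn : ¬ (channelForm r w q (hermMatrix α β g)).PosDef) :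
    α * (q - Complex.normSq r) = β * Complex.normSq r * (1 - q) := by
  have hpsd := channelForm_posSemidef h (hermMatrix_posSemidef_iff.mpr hρ)
  rw [Matrix.posDef_iff_dotProduct_mulVec] at hn
  push Not at hn
  obtain ⟨v, hv0, hv⟩ := hn hpsd.1
  rw [channelForm_hermMatrix, hermMatrix_form, quadForm_channel] at hv
  have f1 := hρ (v 0) (r * v 1)
  have f2 := h (v 0) (v 1)
  have f2' := mul_nonneg hβ.le f2
  have hv' : quadForm α β g (v 0) (r * v 1) +
      β * quadForm (1 - q) (q - Complex.normSq r) w (v 0) (v 1) ≤ 0 := by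
    by_contra hlt
    push Not at hlt
    exact hv (by exact_mod_cast hlt)
  have z1 : quadForm α β g (v 0) (r * v 1) = 0 := by linarith
  have z2 : quadForm (1 - q) (q - Complex.normSq r) w (v 0) (v 1) = 0 := by
    have : β * quadForm (1 - q) (q - Complex.normSq r) w (v 0) (v 1) = 0 := by linarith
    exact (mul_eq_zero.mp this).resolve_left hβ.ne'
  -- The null vector annihilates both pieces. Eliminating `|v 0|²` between the two balance relations
  -- gives the claim, once `v 1 ≠ 0` is known.
  have b1 := quadForm_balance hρ z1
  have b2 := quadForm_balance h z2
  rw [Complex.normSq_mul] at b1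
  have hv1 : Complex.normSq (v 1) ≠ 0 := by
    intro h1
    rw [h1, mul_zero] at b2
    have h0 : Complex.normSq (v 0) = 0 := (mul_eq_zero.mp b2).resolve_left (by linarith)
    apply hv0
    ext i
    fin_cases i
    · exact Complex.normSq_eq_zero.mp h0
    · exact Complex.normSq_eq_zero.mp h1
  apply mul_right_cancel₀ hv1
  calc α * (q - Complex.normSq r) * Complex.normSq (v 1)
      = α * ((1 - q) * Complex.normSq (v 0)) := by rw [b2]; ring
    _ = (1 - q) * (α * Complex.normSq (v 0)) := by ring
    _ = _ := by rw [b1]; ring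

end

lemma exists_sub_posSemidef {x : M2} (hx : x.PosDef) :
    ∃ ε : ℝ, 0 < ε ∧ (x - (ε : ℂ) • (1 : M2)).PosSemidef := by
  have hs := Matrix.isStrictlyPositive_iff_posDef.mpr hx
  obtain ⟨ε, hε, hle⟩ := (CFC.exists_pos_algebraMap_le_iff (a := x)
    (IsSelfAdjoint.of_nonneg hs.nonneg)).mpr (fun y hy => hs.spectrum_pos hy)
  refine ⟨ε, hε, ?_⟩
  have := Matrix.le_iff.mp hle
  rwa [Algebra.algebraMap_eq_smul_one, ← Complex.coe_smul] at this

/-! ### Semigroups of channels: invertibility and the lower bound. -/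

/-- A semigroup of channels of `M_2` that fix the first basis state. -/
structure IsChannelSemigroup (r w : ℝ≥0 → ℂ) (q : ℝ≥0 → ℝ) : Prop where
  form_nonneg : ∀ t v₁ v₂, 0 ≤ quadForm (1 - q t) (q t - Complex.normSq (r t)) (w t) v₁ v₂
  zero : ∀ ρ, channelForm (r 0) (w 0) (q 0) ρ = ρ
  add : ∀ s t ρ, channelForm (r (s + t)) (w (s + t)) (q (s + t)) ρ =
    channelForm (r s) (w s) (q s) (channelForm (r t) (w t) (q t) ρ)

namespace IsChannelSemigroup

variable {r w : ℝ≥0 → ℂ} {q : ℝ≥0 → ℝ}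

lemma q_zero (h : IsChannelSemigroup r w q) : q 0 = 1 := by
  have := congrFun (congrFun (h.zero (Matrix.single 1 1 1)) 1) 1
  simp [channelForm] at this
  exact_mod_cast this

lemma r_zero (h : IsChannelSemigroup r w q) : r 0 = 1 := by
  have := congrFun (congrFun (h.zero (Matrix.single 0 1 1)) 0) 1
  simpa [channelForm] using this

lemma q_add (h : IsChannelSemigroup r w q) (s t : ℝ≥0) : q (s + t) = q s * q t := by
  have := congrFun (congrFun (h.add s t (Matrix.single 1 1 1)) 1) 1
  simp [channelForm] at this
  exact_mod_cast this

lemma r_add (h : IsChannelSemigroup r w q) (s t : ℝ≥0) : r (s + t) = r s * r t := by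
  have := congrFun (congrFun (h.add s t (Matrix.single 0 1 1)) 0) 1
  simpa [channelForm] using this

/-- With `s = |r t|²`, singularity at `t` and at `t + t` gives `α (q - s) = β s (1 - q)` and the
same relation for `q²` and `s²`. Together they force `β s (1 - q) q (1 - s) = 0`, while `0 < s ≤ q <
1` and `β > 0`. -/
lemma exists_posDef (h : IsChannelSemigroup r w q) {t : ℝ≥0} (hr : r t ≠ 0) (hq : q t < 1)
    {ρ : M2} (hρ : ρ.PosSemidef) (hρ1 : ρ 1 1 ≠ 0) : ∃ u, (channelForm (r u) (w u) (q u) ρ).PosDef := by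
  by_contra hn
  push Not at hn
  obtain ⟨α, β, g, rfl⟩ : ∃ α β g, ρ = hermMatrix α β g := ⟨_, _, _, eq_hermMatrix hρ.1⟩
  have hpsd := hermMatrix_posSemidef_iff.mp hρ
  have hβ : 0 < β := by
    have h1 : 0 ≤ β := by simpa [quadForm] using hpsd 0 1
    exact lt_of_le_of_ne h1 fun hz => hρ1 (by simp [hermMatrix, ← hz])
  obtain ⟨-, hs⟩ := one_sub_nonneg_of_form (h.form_nonneg t)
  have hs0 : 0 < Complex.normSq (r t) := Complex.normSq_pos.mpr hr
  have hq2 : q (t + t) < 1 := by rw [h.q_add]; nlinarith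
  have b1 := balance_of_not_posDef (h.form_nonneg t) hpsd hβ hq (hn t)
  have b2 := balance_of_not_posDef (h.form_nonneg (t + t)) hpsd hβ hq2 (hn (t + t))
  rw [h.q_add, h.r_add, Complex.normSq_mul] at b2
  set s := Complex.normSq (r t)
  have b3 : β * s * (1 - q t) * (q t * (1 - s)) = 0 := by
    linear_combination (q t + s) * (-b1) + b2
  have hq0 : 0 < q t := by linarith
  have : 0 < β * s * (1 - q t) * (q t * (1 - s)) := by
    have : 0 < 1 - q t := by linarith
    have : 0 < 1 - s := by linarith
    positivity
  linarith

/-- Lower bound for the evolution of a state other than the first basis state. -/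
lemma exists_lower_bound (h : IsChannelSemigroup r w q) {t : ℝ≥0} (hr : r t ≠ 0) (hq : q t < 1)
    {ρ : M2} (hρ : ρ.PosSemidef) (hρ1 : ρ 1 1 ≠ 0) : ∃ c : ℝ, 0 < c ∧ ∀ᶠ u in atTop,
      (channelForm (r u) (w u) (q u) ρ - ((c * q u : ℝ) : ℂ) • (1 : M2)).PosSemidef := by
  obtain ⟨u₀, hu₀⟩ := h.exists_posDef hr hq hρ hρ1
  obtain ⟨ε, hε, hpos⟩ := exists_sub_posSemidef hu₀
  refine ⟨ε * (2 / 9), by positivity, ?_⟩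
  filter_upwards [eventually_ge_atTop u₀] with u hu
  obtain ⟨s, rfl⟩ := exists_add_of_le hu
  rw [add_comm u₀ s, h.add]
  set σ := channelForm (r u₀) (w u₀) (q u₀) ρ
  have hf := h.form_nonneg s
  -- The first summand stays positive and the image of the second is at least `ε * (2 / 9) * q s`.
  -- This exceeds the required bound because `q u₀ ≤ 1`; the surplus is `p3`.
  have e : σ = (σ - (ε : ℂ) • (1 : M2)) + (ε : ℂ) • (1 : M2) := by simp
  rw [e, channelForm_add, channelForm_smul, h.q_add]
  have p1 := channelForm_posSemidef hf hpos
  have hεc : (0 : ℂ) ≤ (ε : ℂ) := by exact_mod_cast hε.le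
  have p2 := (channelForm_one_sub_posSemidef hf).smul hεc
  obtain ⟨hq1, -⟩ := one_sub_nonneg_of_form (h.form_nonneg u₀)
  obtain ⟨-, hq2⟩ := one_sub_nonneg_of_form hf
  have hqs := (Complex.normSq_nonneg _).trans hq2
  have p3 : (((ε * (2 / 9) * (q s * (1 - q u₀)) : ℝ) : ℂ) • (1 : M2)).PosSemidef := by
    refine Matrix.PosSemidef.one.smul ?_
    have : 0 ≤ 1 - q u₀ := by linarith
    exact_mod_cast (by positivity : 0 ≤ ε * (2 / 9) * (q s * (1 - q u₀)))
  convert (p1.add p2).add p3 using 1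
  push_cast
  module

end IsChannelSemigroup

/-! ### Change of basis and consequences of absorption. -/

/-- The matrix with columns `e₁, e₂`. -/
def frame (e₁ e₂ : H2) : M2 := !![e₁ 0, e₂ 0; e₁ 1, e₂ 1]

section frame

variable {e₁ e₂ : H2}

lemma frame_conjTranspose_mul (he₁ : ‖e₁‖ = 1) (he₂ : ‖e₂‖ = 1) (horth : inner ℂ e₁ e₂ = 0) :
    (frame e₁ e₂)ᴴ * frame e₁ e₂ = 1 := by
  have h1 : inner ℂ e₁ e₁ = (1 : ℂ) := by rw [inner_self_eq_norm_sq_to_K, he₁]; simp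
  have h2 : inner ℂ e₂ e₂ = (1 : ℂ) := by rw [inner_self_eq_norm_sq_to_K, he₂]; simp
  have h3 : inner ℂ e₂ e₁ = (0 : ℂ) := by rw [← inner_conj_symm, horth, map_zero]
  simp only [PiLp.inner_apply, RCLike.inner_apply, Fin.sum_univ_two] at h1 h2 h3 horth
  ext i j
  fin_cases i <;> fin_cases j <;>
    simp [frame, Matrix.mul_apply, Fin.sum_univ_two] <;>
    first
      | linear_combination h1
      | linear_combination h2
      | linear_combination h3
      | linear_combination horth

lemma frame_single_zero : frame e₁ e₂ * Matrix.single 0 0 1 * (frame e₁ e₂)ᴴ = ketbra e₁ := by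
  ext i j
  simp only [Matrix.mul_apply, Fin.sum_univ_two]
  fin_cases i <;> fin_cases j <;> simp [frame, ketbra, Matrix.vecMulVec_apply]

lemma frame_single_one : frame e₁ e₂ * Matrix.single 1 1 1 * (frame e₁ e₂)ᴴ = ketbra e₂ := by
  ext i j
  simp only [Matrix.mul_apply, Fin.sum_univ_two]
  fin_cases i <;> fin_cases j <;> simp [frame, ketbra, Matrix.vecMulVec_apply]

lemma act_left_eq (x : M2) :
    (act x e₁).ofLp = fun i => (x * frame e₁ e₂) i 0 := by
  ext i
  simp [act, frame, Matrix.mul_apply, Fin.sum_univ_two, Matrix.toEuclideanLin, Matrix.mulVec,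
    dotProduct]

lemma act_right_eq (x : M2) :
    (act x e₂).ofLp = fun i => (x * frame e₁ e₂) i 1 := by
  ext i
  simp [act, frame, Matrix.mul_apply, Fin.sum_univ_two, Matrix.toEuclideanLin, Matrix.mulVec,
    dotProduct]

lemma inner_act_right (x : M2) :
    inner ℂ (act x e₂) e₂ = star (((frame e₁ e₂)ᴴ * x * frame e₁ e₂) 1 1) := by
  rw [PiLp.inner_apply]
  simp only [Fin.sum_univ_two, RCLike.inner_apply]
  rw [mul_assoc, Matrix.mul_apply, Fin.sum_univ_two]
  have h := act_right_eq (e₁ := e₁) (e₂ := e₂) x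
  have h0 := congrFun h 0
  have h1 := congrFun h 1
  simp only at h0 h1
  rw [h0, h1]
  simp [frame]

lemma vectorState_right (x : M2) :
    vectorState e₂ x = ((frame e₁ e₂)ᴴ * x * frame e₁ e₂) 1 1 := by
  rw [vectorState_apply]
  simp [frame, Matrix.mul_apply, Matrix.mulVec, dotProduct, Fin.sum_univ_two]
  ring

end frame

/-- A limit of orbits is invariant: the orbit of the absorbing state itself and its shift by `s`
have the same limit. -/
lemma IsAbsorbing.predualMatrix_ketbra {T : ℝ≥0 → (M2 →CP M2)}
    (hT : IsQuantumMarkovSemigroup T) {e : H2}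
    (habs : IsAbsorbing T (vectorState e)) (s : ℝ≥0) :
    predualMatrix (T s) (ketbra e) = ketbra e := by
  refine eq_of_trace_mul_eq fun x => ?_
  rw [trace_predualMatrix_mul]
  have hx : ∀ x, Tendsto (fun t => (vectorState e) (T t x)) atTop (𝓝 (vectorState e x)) :=
    fun x => ((WeakDual.eval_continuous x).tendsto _).comp (habs.2 _ habs.1)
  have h1 := hx (T s x)
  have h2 := (hx x).comp (tendsto_atTop_mono (fun t : ℝ≥0 => (le_self_add : t ≤ t + s)) tendsto_id)
  refine tendsto_nhds_unique h1 (h2.congr fun t => ?_)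
  simp only [Function.comp]
  rw [hT.add]

lemma densityState_mem_stateSpace {ρ : M2} (hρ : IsDensity ρ) : densityState ρ ∈ stateSpace := by
  refine ⟨fun x hx => ?_, by rw [densityState_apply, mul_one, hρ.2]⟩
  obtain ⟨b, rfl⟩ := CStarAlgebra.nonneg_iff_eq_star_mul_self.mp hx
  rw [densityState_apply, Matrix.star_eq_conjTranspose, ← mul_assoc, Matrix.trace_mul_comm,
    ← mul_assoc]
  exact (hρ.1.mul_mul_conjTranspose_same b).trace_nonneg

lemma IsAbsorbing.tendsto_predualMatrix {T : ℝ≥0 → (M2 →CP M2)} {e : H2}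
    (habs : IsAbsorbing T (vectorState e)) {ρ : M2} (hρ : IsDensity ρ) :
    Tendsto (fun t => predualMatrix (T t) ρ) atTop (𝓝 (ketbra e)) := by
  refine tendsto_pi_nhds.mpr fun i => tendsto_pi_nhds.mpr fun j => ?_
  have h := ((WeakDual.eval_continuous (Matrix.single j i (1 : ℂ))).tendsto _).comp
    (habs.2 _ (densityState_mem_stateSpace hρ))
  have e1 : vectorState e (Matrix.single j i (1 : ℂ)) = ketbra e i j := by
    rw [vectorState, densityState_apply, Matrix.trace_mul_single]; simp
  rw [← e1]
  exact h

/-- In a basis that starts with the absorbing vector, the predual semigroup is a semigroup of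
channels that fix the first basis state. -/
lemma exists_isChannelSemigroup {T : ℝ≥0 → (M2 →CP M2)} (hT : IsQuantumMarkovSemigroup T)
    {e₁ e₂ : H2} (he₁ : ‖e₁‖ = 1) (he₂ : ‖e₂‖ = 1) (horth : inner ℂ e₁ e₂ = 0)
    (habs : IsAbsorbing T (vectorState e₁)) :
    ∃ (r w : ℝ≥0 → ℂ) (q : ℝ≥0 → ℝ), IsChannelSemigroup r w q ∧ ∀ t ρ,
      (frame e₁ e₂)ᴴ * predualMatrix (T t) (frame e₁ e₂ * ρ * (frame e₁ e₂)ᴴ) * frame e₁ e₂ =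
        channelForm (r t) (w t) (q t) ρ := by
  set W := frame e₁ e₂ with hW
  have hWW : Wᴴ * W = 1 := frame_conjTranspose_mul he₁ he₂ horth
  have hWW' : W * Wᴴ = 1 := mul_eq_one_comm.mp hWW
  have key : ∀ t, ∃ (r w : ℂ) (q : ℝ),
      (∀ ρ, Wᴴ * predualMatrix (T t) (W * ρ * Wᴴ) * W = channelForm r w q ρ) ∧
      ∀ v₁ v₂, 0 ≤ quadForm (1 - q) (q - Complex.normSq r) w v₁ v₂ := by
    intro t
    obtain ⟨K, hK⟩ := exists_kraus (T t)
    have hV : ∀ ρ, ∑ k, (Wᴴ * K k * W) * ρ * (Wᴴ * K k * W)ᴴ =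
        Wᴴ * predualMatrix (T t) (W * ρ * Wᴴ) * W := by
      intro ρ
      rw [predualMatrix_kraus hK, Finset.mul_sum, Finset.sum_mul]
      refine Finset.sum_congr rfl fun k _ => ?_
      simp only [Matrix.conjTranspose_mul, Matrix.conjTranspose_conjTranspose, mul_assoc]
    have htr : ∀ x : M2, (Wᴴ * x * W).trace = x.trace := fun x => by
      rw [Matrix.trace_mul_comm, ← mul_assoc, hWW', one_mul]
    have htr' : ∀ x : M2, (W * x * Wᴴ).trace = x.trace := fun x => by
      rw [Matrix.trace_mul_comm, ← mul_assoc, hWW, one_mul]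
    obtain ⟨r, w, q, h1, h2⟩ := exists_channelForm (V := fun k => Wᴴ * K k * W)
      (fun ρ => by rw [hV, htr, hT.trace_predualMatrix, htr'])
      (by
        rw [hV, hW, frame_single_zero, habs.predualMatrix_ketbra hT,
          ← frame_single_zero (e₁ := e₁) (e₂ := e₂), ← hW]
        simp only [← mul_assoc, hWW, one_mul]
        rw [mul_assoc, hWW, mul_one])
    exact ⟨r, w, q, fun ρ => by rw [← hV, h1], h2⟩
  choose r w q hcf hform using key
  refine ⟨r, w, q, ⟨hform, fun ρ => ?_, fun s t ρ => ?_⟩, hcf⟩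
  · rw [← hcf, hT.predualMatrix_zero]
    simp only [← mul_assoc, hWW, one_mul]
    rw [mul_assoc, hWW, mul_one]
  · rw [← hcf, ← hcf, ← hcf, hT.predualMatrix_add]
    congr 3
    simp only [← mul_assoc, hWW', one_mul]
    rw [mul_assoc _ W Wᴴ, hWW', mul_one]

/-! ### The generator and its parameters. -/

lemma IsQuantumMarkovSemigroup.exists_isPredualGenerator {T : ℝ≥0 → (M2 →CP M2)}
    (hT : IsQuantumMarkovSemigroup T) : ∃ L, IsPredualGenerator T L := by
  have hc : Continuous fun t => predualCLM (T t) :=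
    continuous_clm_apply.mpr fun ρ => hT.continuous_predualMatrix ρ
  obtain ⟨X, hX⟩ := exists_generator_of_continuous (A := M2 →L[ℂ] M2)
    (F := fun t => predualCLM (T t)) hc
    (by ext1 ρ; exact hT.predualMatrix_zero ρ)
    (fun s t => by ext1 ρ; exact hT.predualMatrix_add s t ρ)
  refine ⟨fun ρ => X ρ, fun ρ => ?_⟩
  exact ((ContinuousLinearMap.apply ℂ M2 ρ).continuous.tendsto X).comp hX

/-- From `|r|² - 1 = 2 Re (r - 1) + |r - 1|²`, whose last term is of order `t²`. -/
lemma tendsto_slope_normSq {r : ℝ≥0 → ℂ} {r' : ℂ}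
    (hr : Tendsto (fun t : ℝ≥0 => (t : ℝ)⁻¹ • (r t - 1)) (𝓝[>] 0) (𝓝 r')) :
    Tendsto (fun t : ℝ≥0 => (t : ℝ)⁻¹ * (Complex.normSq (r t) - 1)) (𝓝[>] 0)
      (𝓝 (2 * r'.re)) := by
  have h1 : Tendsto (fun t : ℝ≥0 => (t : ℝ)) (𝓝[>] 0) (𝓝 0) :=
    tendsto_coe_nhdsGT_zero.mono_right nhdsWithin_le_nhds
  have h2 := (Complex.continuous_normSq.tendsto r').comp hr
  have h3 := (Complex.continuous_re.tendsto r').comp hr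
  have h4 := (h3.const_mul 2).add (h1.mul h2)
  rw [zero_mul, add_zero] at h4
  refine h4.congr' ?_
  filter_upwards [self_mem_nhdsWithin] with t ht
  have ht' : (t : ℝ) ≠ 0 := (NNReal.coe_pos.mpr ht).ne'
  simp [Complex.normSq_apply]
  field_simp
  ring

/-- The generator of a semigroup of channels that fix the first basis state. -/
noncomputable def generatorForm (r' w' : ℂ) (q' : ℝ) (ρ : M2) : M2 :=
  !![-q' * ρ 1 1, r' * ρ 0 1 + w' * ρ 1 1; star r' * ρ 1 0 + star w' * ρ 1 1, q' * ρ 1 1]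

/-- The two jump operators send the second basis vector to the columns of `C` and kill the first, so
together they contribute `ρ 1 1 • (C * Cᴴ)`. -/
lemma generatorForm_eq (r' w' : ℂ) (q' : ℝ) {C : M2}
    (hC : hermMatrix (-q') (q' - 2 * r'.re) w' = C * Cᴴ) (ρ : M2) :
    generatorForm r' w' q' ρ =
      (star r' • Matrix.single 1 1 1) * ρ + ρ * (star r' • Matrix.single 1 1 (1 : ℂ))ᴴ +
      ((C * Matrix.single 0 1 1) * ρ * (C * Matrix.single 0 1 1)ᴴ +
        (C * Matrix.single 1 1 1) * ρ * (C * Matrix.single 1 1 1)ᴴ) := by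
  have h1 : (C * Matrix.single 0 1 1) * ρ * (C * Matrix.single 0 1 1)ᴴ +
        (C * Matrix.single 1 1 1) * ρ * (C * Matrix.single 1 1 1)ᴴ = ρ 1 1 • (C * Cᴴ) := by
    ext i j
    simp only [Matrix.conjTranspose_mul, Matrix.add_apply, Matrix.mul_apply, Fin.sum_univ_two,
      Matrix.conjTranspose_apply, Matrix.smul_apply, smul_eq_mul, Matrix.single_apply]
    simp
    ring
  rw [h1, ← hC]
  ext i j
  simp only [Matrix.add_apply, Matrix.mul_apply, Fin.sum_univ_two, Matrix.smul_apply,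
    Matrix.conjTranspose_apply, Matrix.single_apply]
  fin_cases i <;> fin_cases j <;> simp [generatorForm, hermMatrix, Complex.re_eq_add_conj] <;> ring

namespace IsChannelSemigroup

variable {r w : ℝ≥0 → ℂ} {q : ℝ≥0 → ℝ} {r' w' : ℂ} {q' : ℝ}

lemma tendsto_channelForm
    (hr : Tendsto (fun t : ℝ≥0 => (t : ℝ)⁻¹ • (r t - 1)) (𝓝[>] 0) (𝓝 r'))
    (hw : Tendsto (fun t : ℝ≥0 => (t : ℝ)⁻¹ • w t) (𝓝[>] 0) (𝓝 w'))
    (hq : Tendsto (fun t : ℝ≥0 => (t : ℝ)⁻¹ * (q t - 1)) (𝓝[>] 0) (𝓝 q')) (ρ : M2) :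
    Tendsto (fun t : ℝ≥0 => (t : ℝ)⁻¹ • (channelForm (r t) (w t) (q t) ρ - ρ)) (𝓝[>] 0)
      (𝓝 (generatorForm r' w' q' ρ)) := by
  have hqc := (Complex.continuous_ofReal.tendsto q').comp hq
  have hrs := (continuous_star.tendsto r').comp hr
  have hws := (continuous_star.tendsto w').comp hw
  refine tendsto_pi_nhds.mpr fun i => tendsto_pi_nhds.mpr fun j => ?_
  fin_cases i <;> fin_cases j
  · refine (hqc.neg.mul_const (ρ 1 1)).congr fun t => ?_
    simp [channelForm]; ring
  · refine ((hr.mul_const (ρ 0 1)).add (hw.mul_const (ρ 1 1))).congr fun t => ?_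
    simp [channelForm]; ring
  · refine ((hrs.mul_const (ρ 1 0)).add (hws.mul_const (ρ 1 1))).congr fun t => ?_
    simp [channelForm]; ring
  · refine (hqc.mul_const (ρ 1 1)).congr fun t => ?_
    simp [channelForm]; ring

/-- The noise forms are nonnegative and vanish at `t = 0`, so their derivative there is nonnegative.
Its factorization supplies `z₁` and `z₂`. -/
lemma generator_posSemidef (h : IsChannelSemigroup r w q)
    (hr : Tendsto (fun t : ℝ≥0 => (t : ℝ)⁻¹ • (r t - 1)) (𝓝[>] 0) (𝓝 r'))
    (hw : Tendsto (fun t : ℝ≥0 => (t : ℝ)⁻¹ • w t) (𝓝[>] 0) (𝓝 w'))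
    (hq : Tendsto (fun t : ℝ≥0 => (t : ℝ)⁻¹ * (q t - 1)) (𝓝[>] 0) (𝓝 q')) :
    (hermMatrix (-q') (q' - 2 * r'.re) w').PosSemidef := by
  rw [hermMatrix_posSemidef_iff]
  intro v₁ v₂
  have h1 : Tendsto (fun t : ℝ≥0 => (t : ℝ)⁻¹ *
      quadForm (1 - q t) (q t - Complex.normSq (r t)) (w t) v₁ v₂) (𝓝[>] 0)
      (𝓝 (quadForm (-q') (q' - 2 * r'.re) w' v₁ v₂)) := by
    have a1 := hq.neg.mul_const (Complex.normSq v₁)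
    have a2 := (hq.sub (tendsto_slope_normSq hr)).mul_const (Complex.normSq v₂)
    have a3 := (Complex.continuous_re.tendsto _).comp ((hw.const_mul (star v₁)).mul_const v₂)
    refine ((a1.add (a3.const_mul 2)).add a2).congr fun t => ?_
    have : (star v₁ * ((t : ℝ)⁻¹ • w t) * v₂).re = (t : ℝ)⁻¹ * (star v₁ * w t * v₂).re := by
      rw [mul_smul_comm, smul_mul_assoc, Complex.smul_re, smul_eq_mul]
    simp only [Function.comp, this, quadForm]
    ring
  exact ge_of_tendsto' h1 fun t => mul_nonneg (by positivity) (h.form_nonneg t _ _)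

end IsChannelSemigroup

lemma IsPredualGenerator.tendsto_conj {T : ℝ≥0 → (M2 →CP M2)} {L : M2 → M2}
    (hL : IsPredualGenerator T L) {W : M2} (hWW : Wᴴ * W = 1) {r w : ℝ≥0 → ℂ} {q : ℝ≥0 → ℝ}
    (hcf : ∀ t ρ, Wᴴ * predualMatrix (T t) (W * ρ * Wᴴ) * W = channelForm (r t) (w t) (q t) ρ)
    (ρ : M2) :
    Tendsto (fun t : ℝ≥0 => (t : ℝ)⁻¹ • (channelForm (r t) (w t) (q t) ρ - ρ)) (𝓝[>] 0)
      (𝓝 (Wᴴ * L (W * ρ * Wᴴ) * W)) := by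
  refine (((hL (W * ρ * Wᴴ)).const_mul Wᴴ).mul_const W).congr fun t => ?_
  rw [mul_smul_comm, smul_mul_assoc, mul_sub, sub_mul, hcf]
  congr 2
  simp only [← mul_assoc, hWW, one_mul]
  rw [mul_assoc, hWW, mul_one]

lemma tendsto_entry {X : Type*} {l : Filter X} {f : X → M2} {a : M2} (h : Tendsto f l (𝓝 a))
    (i j : Fin 2) : Tendsto (fun t => f t i j) l (𝓝 (a i j)) :=
  tendsto_pi_nhds.mp (tendsto_pi_nhds.mp h i) j

lemma act_left_eq_zero_iff {e₁ e₂ : H2} (hWW : (frame e₁ e₂)ᴴ * frame e₁ e₂ = 1) {x : M2} :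
    act x e₁ = 0 ↔ ∀ i, ((frame e₁ e₂)ᴴ * x * frame e₁ e₂) i 0 = 0 := by
  have hWW' := mul_eq_one_comm.mp hWW
  have h : act x e₁ = 0 ↔ ∀ i, (x * frame e₁ e₂) i 0 = 0 := by
    rw [← WithLp.ofLp_eq_zero 2, act_left_eq (e₂ := e₂), funext_iff]; rfl
  rw [h, mul_assoc]
  generalize hx : x * frame e₁ e₂ = z
  constructor
  · intro h0 i
    simp [Matrix.mul_apply, h0]
  · intro h0 i
    have : z = frame e₁ e₂ * ((frame e₁ e₂)ᴴ * z) := by rw [← mul_assoc, hWW', one_mul]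
    rw [this, Matrix.mul_apply]
    exact Finset.sum_eq_zero fun k _ => by rw [h0, mul_zero]

lemma exists_isGeneratorParameters {T : ℝ≥0 → (M2 →CP M2)} (hT : IsQuantumMarkovSemigroup T)
    {e₁ e₂ : H2} (he₁ : ‖e₁‖ = 1) (he₂ : ‖e₂‖ = 1) (horth : inner ℂ e₁ e₂ = 0)
    (habs : IsAbsorbing T (vectorState e₁)) :
    ∃ y z₁ z₂ : M2, IsGeneratorParameters T e₁ y z₁ z₂ := by
  obtain ⟨r, w, q, h, hcf⟩ := exists_isChannelSemigroup hT he₁ he₂ horth habs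
  have hWW := frame_conjTranspose_mul he₁ he₂ horth
  have hact : ∀ {x : M2}, act x e₁ = 0 ↔ _ := act_left_eq_zero_iff hWW
  obtain ⟨L, hL⟩ := hT.exists_isPredualGenerator
  generalize frame e₁ e₂ = W at *
  have hWW' := mul_eq_one_comm.mp hWW
  have hlim := hL.tendsto_conj hWW hcf
  obtain ⟨r', hr⟩ : ∃ r' : ℂ, Tendsto (fun t : ℝ≥0 => (t : ℝ)⁻¹ • (r t - 1)) (𝓝[>] 0) (𝓝 r') :=
    ⟨_, (tendsto_entry (hlim (Matrix.single 0 1 1)) 0 1).congr fun t => by simp [channelForm]⟩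
  obtain ⟨w', hw⟩ : ∃ w' : ℂ, Tendsto (fun t : ℝ≥0 => (t : ℝ)⁻¹ • w t) (𝓝[>] 0) (𝓝 w') :=
    ⟨_, (tendsto_entry (hlim (Matrix.single 1 1 1)) 0 1).congr fun t => by simp [channelForm]⟩
  obtain ⟨q', hq⟩ : ∃ q' : ℝ, Tendsto (fun t : ℝ≥0 => (t : ℝ)⁻¹ * (q t - 1)) (𝓝[>] 0) (𝓝 q') :=
    ⟨_, ((Complex.continuous_re.tendsto _).comp
      (tendsto_entry (hlim (Matrix.single 1 1 1)) 1 1)).congr fun t => by simp [channelForm]⟩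
  obtain ⟨B, hB⟩ := CStarAlgebra.nonneg_iff_eq_star_mul_self.mp
    (Matrix.nonneg_iff_posSemidef.mpr (h.generator_posSemidef hr hw hq))
  have hC : hermMatrix (-q') (q' - 2 * r'.re) w' = Bᴴ * Bᴴᴴ := by
    rw [hB, Matrix.conjTranspose_conjTranspose]; rfl
  have hLeq : ∀ ρ, Wᴴ * L (W * ρ * Wᴴ) * W = generatorForm r' w' q' ρ := fun ρ =>
    tendsto_nhds_unique (hlim ρ) (IsChannelSemigroup.tendsto_channelForm hr hw hq ρ)
  have hconj : ∀ x : M2, Wᴴ * (W * x * Wᴴ) * W = x := fun x => by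
    simp only [← mul_assoc, hWW, one_mul]
    rw [mul_assoc, hWW, mul_one]
  have hconj' : ∀ x : M2, W * (Wᴴ * x * W) * Wᴴ = x := fun x => by
    simp only [← mul_assoc, hWW', one_mul]
    rw [mul_assoc, hWW', mul_one]
  have hmul : ∀ x z : M2, Wᴴ * (x * z) * W = (Wᴴ * x * W) * (Wᴴ * z * W) := fun x z => by
    have : x * z = x * (W * Wᴴ) * z := by rw [hWW', mul_one]
    rw [this]
    simp only [mul_assoc]
  have hstar : ∀ x : M2, Wᴴ * xᴴ * W = (Wᴴ * x * W)ᴴ := fun x => by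
    simp [Matrix.conjTranspose_mul, mul_assoc]
  obtain ⟨y, hy⟩ : ∃ y, Wᴴ * y * W = star r' • Matrix.single 1 1 1 := ⟨_, hconj _⟩
  obtain ⟨z₁, hz₁⟩ : ∃ z, Wᴴ * z * W = Bᴴ * Matrix.single 0 1 1 := ⟨_, hconj _⟩
  obtain ⟨z₂, hz₂⟩ : ∃ z, Wᴴ * z * W = Bᴴ * Matrix.single 1 1 1 := ⟨_, hconj _⟩
  refine ⟨y, z₁, z₂, ⟨?_, ?_, ?_, ?_, ?_⟩⟩
  · convert hL using 1
    funext ρ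
    rw [← hconj' (L ρ)]
    conv_rhs => rw [← hconj' ρ]
    rw [hLeq, generatorForm_eq _ _ _ hC, ← hy, ← hz₁, ← hz₂, ← hconj' (_ + _)]
    simp only [mul_add, add_mul, hmul, hstar]
  · rw [hact, hy]
    intro i
    fin_cases i <;> simp
  · rw [hact, hstar, hy]
    intro i
    fin_cases i <;> simp [Matrix.conjTranspose_apply]
  · rw [hact, hz₁]
    intro i
    simp
  · rw [hact, hz₂]
    intro i
    simp

/-! ### The decay rate in terms of the parameters. -/

lemma act_ofLp (x : M2) (v : H2) : (act x v).ofLp = x *ᵥ v.ofLp := rfl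

lemma mem_realEigenvalues_iff {x : M2} {r : ℝ} :
    r ∈ realEigenvalues x ↔ ∃ v : H2, v ≠ 0 ∧ act x v = (r : ℂ) • v := by
  constructor
  · intro h
    obtain ⟨v, hv⟩ := Module.End.HasEigenvalue.exists_hasEigenvector h
    exact ⟨v, hv.2, Module.End.mem_eigenspace_iff.mp hv.1⟩
  · rintro ⟨v, hv, h⟩
    exact Module.End.hasEigenvalue_of_hasEigenvector ⟨Module.End.mem_eigenspace_iff.mpr h, hv⟩

/-- The matrix is unitarily equivalent to `diag(0, c)`; the sign of `c` decides which entry is the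
greatest. -/
lemma greatest_eigenvalue_eq {x W : M2} (hWW : Wᴴ * W = 1) {c η : ℝ} (hc : 0 ≤ c)
    (hx : Wᴴ * x * W = (c : ℂ) • Matrix.single 1 1 1) (hη : IsGreatest (realEigenvalues x) η) :
    η = c := by
  have hWW' := mul_eq_one_comm.mp hWW
  have hmem : c ∈ realEigenvalues x := by
    rw [mem_realEigenvalues_iff]
    refine ⟨WithLp.toLp 2 (W *ᵥ Pi.single 1 1), fun h0 => ?_, ?_⟩
    · have h1 : W *ᵥ Pi.single 1 1 = 0 := by simpa using h0
      have h2 : Wᴴ *ᵥ (W *ᵥ Pi.single 1 1) = 0 := by rw [h1, Matrix.mulVec_zero]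
      rw [Matrix.mulVec_mulVec, hWW, Matrix.one_mulVec] at h2
      simpa using congrFun h2 1
    · have h1 : x * W = W * ((c : ℂ) • Matrix.single 1 1 1) := by
        rw [← hx, ← mul_assoc, ← mul_assoc, hWW', one_mul]
      apply WithLp.ofLp_injective
      simp only [act_ofLp, Matrix.mulVec_mulVec, WithLp.ofLp_smul]
      rw [h1]
      ext i
      simp [mul_comm]
  obtain ⟨v, hv0, hv⟩ := mem_realEigenvalues_iff.mp hη.1
  have hle : c ≤ η := hη.2 hmem
  have hv' := congrArg (fun u : H2 => Wᴴ *ᵥ u.ofLp) hv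
  simp only [act_ofLp, WithLp.ofLp_smul, Matrix.mulVec_mulVec,
    Matrix.mulVec_smul] at hv'
  set u := Wᴴ *ᵥ v.ofLp with hu
  have hvu : v.ofLp = W *ᵥ u := by rw [hu, Matrix.mulVec_mulVec, hWW', Matrix.one_mulVec]
  rw [hvu, Matrix.mulVec_mulVec, hx] at hv'
  have c0 := congrFun hv' 0
  have c1 := congrFun hv' 1
  simp [Matrix.mulVec, dotProduct, Fin.sum_univ_two] at c0 c1
  rcases c0 with c0 | c0
  · rw [c0] at hle ⊢; linarith
  · rcases c1 with c1 | c1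
    · exact_mod_cast c1.symm
    · exfalso
      apply hv0
      apply WithLp.ofLp_injective
      have hz : u = 0 := by
        ext i; fin_cases i
        · exact c0
        · exact c1
      rw [hvu, hz, Matrix.mulVec_zero]; rfl

/-- The decay rate of the second diagonal entry is determined by the generator parameters. -/
lemma IsGeneratorParameters.tendsto_q {T : ℝ≥0 → (M2 →CP M2)} {e₁ e₂ : H2}
    (hWW : (frame e₁ e₂)ᴴ * frame e₁ e₂ = 1) {r w : ℝ≥0 → ℂ} {q : ℝ≥0 → ℝ}
    (hcf : ∀ t ρ, (frame e₁ e₂)ᴴ * predualMatrix (T t) (frame e₁ e₂ * ρ * (frame e₁ e₂)ᴴ) *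
      frame e₁ e₂ = channelForm (r t) (w t) (q t) ρ) {y z₁ z₂ : M2}
    (hp : IsGeneratorParameters T e₁ y z₁ z₂) {η a : ℝ}
    (hη : IsGreatest (realEigenvalues (-(y + yᴴ))) η)
    (ha : a = ‖inner ℂ (act z₁ e₂) e₂‖ ^ 2 + ‖inner ℂ (act z₂ e₂) e₂‖ ^ 2) :
    Tendsto (fun t : ℝ≥0 => (t : ℝ)⁻¹ * (q t - 1)) (𝓝[>] 0) (𝓝 (a - η)) := by
  have hy := (act_left_eq_zero_iff hWW).mp hp.y_apply
  have hys := (act_left_eq_zero_iff hWW).mp hp.y_adjoint_apply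
  have hz₁ := (act_left_eq_zero_iff hWW).mp hp.z₁_apply
  have hz₂ := (act_left_eq_zero_iff hWW).mp hp.z₂_apply
  rw [inner_act_right (e₁ := e₁), inner_act_right (e₁ := e₁), norm_star, norm_star] at ha
  have hlim := hp.generator.tendsto_conj hWW hcf (Matrix.single 1 1 1)
  generalize frame e₁ e₂ = W at *
  have hWW' := mul_eq_one_comm.mp hWW
  have hmul : ∀ x z : M2, Wᴴ * (x * z) * W = (Wᴴ * x * W) * (Wᴴ * z * W) := fun x z => by
    have : x * z = x * (W * Wᴴ) * z := by rw [hWW', mul_one]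
    rw [this]
    simp only [mul_assoc]
  have hstar : ∀ x : M2, Wᴴ * xᴴ * W = (Wᴴ * x * W)ᴴ := fun x => by
    simp [Matrix.conjTranspose_mul, mul_assoc]
  have hconj : ∀ x : M2, Wᴴ * (W * x * Wᴴ) * W = x := fun x => by
    simp only [← mul_assoc, hWW, one_mul]
    rw [mul_assoc, hWW, mul_one]
  obtain ⟨E, hE⟩ : ∃ E, E = W * Matrix.single 1 1 1 * Wᴴ := ⟨_, rfl⟩
  have hE' : Wᴴ * E * W = Matrix.single 1 1 1 := by rw [hE, hconj]
  rw [← hE] at hlim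
  simp only [mul_add, add_mul, hmul, hstar, hE'] at hlim
  rw [hstar] at hys
  have hx : Wᴴ * (-(y + yᴴ)) * W = -(Wᴴ * y * W + (Wᴴ * y * W)ᴴ) := by
    rw [← hstar]; simp [mul_add, add_mul]
  generalize Wᴴ * y * W = y' at *
  generalize Wᴴ * z₁ * W = x₁ at *
  generalize Wᴴ * z₂ * W = x₂ at *
  have hy0 : ∀ i, y' 0 i = 0 := fun i => by simpa [Matrix.conjTranspose_apply] using hys i
  have h11 := (Complex.continuous_re.tendsto _).comp (tendsto_entry hlim 1 1)
  have h00 := (Complex.continuous_re.tendsto _).comp (tendsto_entry hlim 0 0)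
  have e11 : Tendsto (fun t : ℝ≥0 => (t : ℝ)⁻¹ * (q t - 1)) (𝓝[>] 0)
      (𝓝 (2 * (y' 1 1).re + a)) := by
    convert h11 using 1
    · funext t; simp [channelForm]
    · congr 1
      simp [ha, ← Complex.normSq_eq_norm_sq, Complex.normSq_apply, Matrix.mul_apply,
        Fin.sum_univ_two]
      ring
  -- The upper diagonal entry shows that the rate is nonpositive. Compared with `e11` this yields
  -- `-2 Re (y' 1 1) ≥ a ≥ 0`, so that this number, and not `0`, is the greatest eigenvalue.
  have e00 : Tendsto (fun t : ℝ≥0 => (t : ℝ)⁻¹ * (q t - 1)) (𝓝[>] 0)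
      (𝓝 (-(Complex.normSq (x₁ 0 1) + Complex.normSq (x₂ 0 1)))) := by
    convert h00.neg using 1
    · funext t; simp [channelForm]; ring
    · congr 1
      simp [Complex.normSq_apply, Matrix.mul_apply, Fin.sum_univ_two, hy0]
  have heq := tendsto_nhds_unique e11 e00
  have ha0 : 0 ≤ a := by rw [ha]; positivity
  have n1 := Complex.normSq_nonneg (x₁ 0 1)
  have n2 := Complex.normSq_nonneg (x₂ 0 1)
  have hηc : η = -2 * (y' 1 1).re := by
    refine greatest_eigenvalue_eq hWW (by linarith) ?_ hη
    rw [hx]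
    ext i j
    fin_cases i <;> fin_cases j <;> simp [hy0, hy, Complex.re_eq_add_conj]
    ring
  rw [hηc]
  convert e11 using 2
  ring

/-! ### Large deviations for two atoms. -/

lemma tendsto_one_div_coe : Tendsto (fun t : ℝ≥0 => 1 / (t : ℝ)) atTop (𝓝 0) := by
  simp only [one_div]
  exact tendsto_inv_atTop_zero.comp (NNReal.tendsto_coe_atTop.mpr tendsto_id)

lemma tendsto_inv_mul_log {b : ℝ≥0 → ℝ} {c C D : ℝ} (hC : 0 < C) (hD : 0 < D)
    (hl : ∀ᶠ t : ℝ≥0 in atTop, C * Real.exp (c * t) ≤ b t)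
    (hu : ∀ᶠ t : ℝ≥0 in atTop, b t ≤ D * Real.exp (c * t)) :
    Tendsto (fun t : ℝ≥0 => 1 / (t : ℝ) * Real.log (b t)) atTop (𝓝 c) := by
  have hlim : ∀ A : ℝ, Tendsto (fun t : ℝ≥0 => 1 / (t : ℝ) * Real.log A + c) atTop (𝓝 c) := by
    intro A
    simpa using (tendsto_one_div_coe.mul_const (Real.log A)).add_const c
  have hform : ∀ A : ℝ, 0 < A → ∀ t : ℝ≥0, 0 < t →
      1 / (t : ℝ) * Real.log (A * Real.exp (c * t)) = 1 / (t : ℝ) * Real.log A + c := by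
    intro A hA t ht
    have ht' : (t : ℝ) ≠ 0 := (NNReal.coe_pos.mpr ht).ne'
    rw [Real.log_mul hA.ne' (Real.exp_pos _).ne', Real.log_exp]
    field_simp
  refine tendsto_of_tendsto_of_tendsto_of_le_of_le' (hlim C) (hlim D) ?_ ?_
  · filter_upwards [hl, eventually_gt_atTop 0] with t h1 ht
    rw [← hform C hC t ht]
    exact mul_le_mul_of_nonneg_left (Real.log_le_log (by positivity) h1) (by positivity)
  · filter_upwards [hl, hu, eventually_gt_atTop 0] with t h1 h2 ht
    rw [← hform D hD t ht]
    have : 0 < C * Real.exp (c * t) := by positivity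
    exact mul_le_mul_of_nonneg_left (Real.log_le_log (by linarith) h2) (by positivity)

lemma ofReal_rpow_eq_exp {b : ℝ≥0} (hb : 0 < b) (s : ℝ) :
    (b : ℝ≥0∞) ^ s = ENNReal.ofReal (Real.exp (s * Real.log b)) := by
  have hb' : (0 : ℝ) < b := NNReal.coe_pos.mpr hb
  rw [← ENNReal.ofReal_coe_nnreal, ENNReal.ofReal_rpow_of_pos hb',
    Real.rpow_def_of_pos hb', mul_comm]

lemma two_atoms_apply {X : Type*} [MeasurableSpace X] (c d : ℝ≥0∞) (x y : X) {A : Set X}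
    (hA : MeasurableSet A) : (c • Measure.dirac x + d • Measure.dirac y) A =
      c * A.indicator 1 x + d * A.indicator 1 y := by
  simp only [Measure.coe_add, Measure.coe_smul, Pi.add_apply, Pi.smul_apply, smul_eq_mul,
    Measure.dirac_apply' _ hA]

/-- Large deviations of probability measures carried by two converging atoms, the second of which
has an exponentially small weight. -/
lemma largeDeviationPrinciple_two_atoms {X : Type*} [TopologicalSpace X] [MeasurableSpace X]
    [BorelSpace X] [T1Space X] {μ : ℝ≥0 → Measure X} {b : ℝ≥0 → ℝ≥0} {M m : ℝ≥0 → X} {p p' : X}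
    {J : X → ℝ≥0∞} {κ : ℝ} (hκ : 0 ≤ κ) (hb : ∀ t, b t ≤ 1 / 2)
    (hμ : ∀ t, μ t = ((1 - b t : ℝ≥0) : ℝ≥0∞) • Measure.dirac (M t)
      + (b t : ℝ≥0∞) • Measure.dirac (m t))
    (hM : Tendsto M atTop (𝓝 p)) (hm : Tendsto m atTop (𝓝 p')) (hbpos : ∀ᶠ t in atTop, 0 < b t)
    (hlog : Tendsto (fun t : ℝ≥0 => 1 / (t : ℝ) * Real.log (b t)) atTop (𝓝 (-κ)))
    (hJp : J p = 0) (hJp' : J p' = ENNReal.ofReal κ)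
    (hJ : ∀ x, x ≠ p → x ≠ p' → J x = ⊤) : LargeDeviationPrinciple μ J := by
  have hb1 : ∀ t, b t ≤ 1 := fun t => (hb t).trans (by norm_num [div_le_one])
  have hprob : ∀ t, IsProbabilityMeasure (μ t) := fun t => ⟨by
    rw [hμ t]
    simp only [Measure.coe_add, Measure.coe_smul, Pi.add_apply, Pi.smul_apply, measure_univ,
      smul_eq_mul, mul_one]
    rw [← ENNReal.coe_add, tsub_add_cancel_of_le (hb1 t), ENNReal.coe_one]⟩
  have hval : ∀ t (A : Set X), MeasurableSet A → μ t A =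
      ((1 - b t : ℝ≥0) : ℝ≥0∞) * A.indicator 1 (M t) + (b t : ℝ≥0∞) * A.indicator 1 (m t) := by
    intro t A hA
    rw [hμ t, two_atoms_apply _ _ _ _ hA]
  have hexp0 : EReal.exp (-(J p : EReal)) = 1 := by simp [hJp]
  have hexp1 : EReal.exp (-(J p' : EReal)) = ENNReal.ofReal (Real.exp (-κ)) := by
    rw [hJp', EReal.coe_ennreal_ofReal, max_eq_left hκ, ← EReal.coe_neg, EReal.exp_coe]
  have hblim : Tendsto (fun t : ℝ≥0 => (b t : ℝ≥0∞) ^ (1 / (t : ℝ))) atTop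
      (𝓝 (ENNReal.ofReal (Real.exp (-κ)))) := by
    refine ((ENNReal.continuous_ofReal.tendsto _).comp
      ((Real.continuous_exp.tendsto _).comp hlog)).congr' ?_
    filter_upwards [hbpos] with t ht
    rw [ofReal_rpow_eq_exp ht]; rfl
  -- The heavy atom always has mass at least `1 / 2`, which is invisible at the exponential scale.
  have hhalf : Tendsto (fun t : ℝ≥0 => ((1 / 2 : ℝ≥0) : ℝ≥0∞) ^ (1 / (t : ℝ))) atTop (𝓝 1) := by
    have h1 := (ENNReal.continuous_ofReal.tendsto _).comp ((Real.continuous_exp.tendsto _).comp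
      (tendsto_one_div_coe.mul_const (Real.log (1 / 2 : ℝ≥0))))
    simp only [zero_mul, Real.exp_zero, ENNReal.ofReal_one] at h1
    refine h1.congr fun t => ?_
    rw [ofReal_rpow_eq_exp (by norm_num)]; rfl
  refine ⟨hprob, ?_, fun F hF => ?_, fun G hG => ?_⟩
  · rw [lowerSemicontinuous_iff_isClosed_preimage]
    intro y
    by_cases hy : y = ⊤
    · simp [hy]
    -- Finite sublevels of `J` lie in `{p, p'}`, and finite sets are closed in a T1 space.
    · refine Set.Finite.isClosed (Set.Finite.subset (Set.toFinite {p, p'}) fun x hx => ?_)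
      by_contra hne
      simp only [Set.mem_insert_iff, Set.mem_singleton_iff, not_or] at hne
      have hx' : J x ≤ y := hx
      rw [hJ x hne.1 hne.2, top_le_iff] at hx'
      exact hy hx'
  · by_cases hp : p ∈ F
    · refine le_trans ?_ (le_iSup₂_of_le p hp hexp0.ge)
      refine limsup_le_of_le (by isBoundedDefault) (Eventually.of_forall fun t => ?_)
      have := hprob t
      exact ENNReal.rpow_le_one prob_le_one (by positivity)
    · have hMF : ∀ᶠ t in atTop, M t ∉ F := hM.eventually (hF.isOpen_compl.mem_nhds hp)
      by_cases hp' : p' ∈ F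
      · refine le_trans ?_ (le_iSup₂_of_le p' hp' hexp1.ge)
        rw [← hblim.limsup_eq]
        refine limsup_le_limsup ?_ (by isBoundedDefault) (by isBoundedDefault)
        filter_upwards [hMF] with t ht
        refine ENNReal.rpow_le_rpow ?_ (by positivity)
        rw [hval t F hF.measurableSet, Set.indicator_of_notMem ht, mul_zero, zero_add]
        refine mul_le_of_le_one_right' ?_
        exact Set.indicator_le_self' (fun _ _ => zero_le) _
      · have hmF : ∀ᶠ t in atTop, m t ∉ F := hm.eventually (hF.isOpen_compl.mem_nhds hp')
        refine le_trans (le_of_eq ?_) bot_le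
        refine Tendsto.limsup_eq (tendsto_const_nhds.congr' ?_)
        -- Positivity of `t` matters: at `t = 0` the exponent `1 / t` is `0`, and `0 ^ 0 = 1`.
        filter_upwards [hMF, hmF, eventually_gt_atTop 0] with t h1 h2 ht
        rw [hval t F hF.measurableSet, Set.indicator_of_notMem h1, Set.indicator_of_notMem h2,
          mul_zero, mul_zero, add_zero, ENNReal.zero_rpow_of_pos (by positivity)]
        rfl
  · refine iSup₂_le fun x hx => ?_
    by_cases hxp : x = p
    · subst hxp
      rw [hexp0, ← hhalf.liminf_eq]
      refine liminf_le_liminf ?_ (by isBoundedDefault) (by isBoundedDefault)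
      filter_upwards [hM.eventually (hG.mem_nhds hx)] with t ht
      refine ENNReal.rpow_le_rpow ?_ (by positivity)
      rw [hval t G hG.measurableSet, Set.indicator_of_mem ht, Pi.one_apply, mul_one]
      refine le_add_right (ENNReal.coe_le_coe.mpr ?_)
      refine le_tsub_of_add_le_left ?_
      calc b t + 1 / 2 ≤ 1 / 2 + 1 / 2 := by gcongr; exact hb t
        _ = 1 := by norm_num [add_halves]
    · by_cases hxp' : x = p'
      · subst hxp'
        rw [hexp1, ← hblim.liminf_eq]
        refine liminf_le_liminf ?_ (by isBoundedDefault) (by isBoundedDefault)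
        filter_upwards [hm.eventually (hG.mem_nhds hx)] with t ht
        refine ENNReal.rpow_le_rpow ?_ (by positivity)
        rw [hval t G hG.measurableSet, Set.indicator_of_mem ht, Pi.one_apply, mul_one]
        exact le_add_self
      · rw [hJ x hxp hxp']
        simp

lemma two_atoms_real_eq {X : Type*} [TopologicalSpace X] [MeasurableSpace X]
    [BorelSpace X] {μ : ℝ≥0 → Measure X} {b : ℝ≥0 → ℝ≥0} {M m : ℝ≥0 → X} {p p' : X}
    (hμ : ∀ t, μ t = ((1 - b t : ℝ≥0) : ℝ≥0∞) • Measure.dirac (M t)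
      + (b t : ℝ≥0∞) • Measure.dirac (m t))
    (hM : Tendsto M atTop (𝓝 p)) (hm : Tendsto m atTop (𝓝 p')) {G : Set X} (hG : IsOpen G)
    (hp' : p' ∈ G) (hp : p ∉ closure G) : ∀ᶠ t in atTop, (μ t).real G = b t := by
  filter_upwards [hm.eventually (hG.mem_nhds hp'),
    hM.eventually (isClosed_closure.isOpen_compl.mem_nhds hp)] with t h1 h2
  have h2' : M t ∉ G := fun h => h2 (subset_closure h)
  rw [Measure.real, hμ t, two_atoms_apply _ _ _ _ hG.measurableSet, Set.indicator_of_notMem h2',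
    Set.indicator_of_mem h1]
  simp

/-! ### Eigenvalues and orthogonal measures. -/

lemma densityState_injective : Function.Injective densityState := fun a b h =>
  eq_of_trace_mul_eq fun x => by rw [← densityState_apply, ← densityState_apply, h]

lemma continuous_densityState : Continuous densityState := by
  refine WeakDual.continuous_of_continuous_eval fun x => ?_
  simp only [densityState_apply]
  exact Continuous.matrix_trace (continuous_id.mul continuous_const)

lemma ketbra_add_ketbra {e₁ e₂ : H2} (he₁ : ‖e₁‖ = 1) (he₂ : ‖e₂‖ = 1)
    (horth : inner ℂ e₁ e₂ = 0) : ketbra e₁ + ketbra e₂ = 1 := by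
  have hWW' := mul_eq_one_comm.mp (frame_conjTranspose_mul he₁ he₂ horth)
  rw [← frame_single_zero (e₁ := e₁) (e₂ := e₂), ← frame_single_one (e₁ := e₁) (e₂ := e₂),
    ← add_mul, ← mul_add]
  have : (Matrix.single 0 0 1 + Matrix.single 1 1 1 : M2) = 1 := by
    ext i j
    fin_cases i <;> fin_cases j <;> simp
  rw [this, mul_one, hWW']

lemma vectorState_ketbra_self {e : H2} (he : ‖e‖ = 1) : vectorState e (ketbra e) = 1 := by
  rw [vectorState, densityState_apply, ketbra_idem he, ketbra_trace he]

lemma vectorState_one {e : H2} (he : ‖e‖ = 1) : vectorState e 1 = 1 :=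
  (vectorState_mem_stateSpace he).2

lemma vectorState_ketbra_of_add {e f : H2} (he : ‖e‖ = 1) (h : ketbra f + ketbra e = 1) :
    vectorState e (ketbra f) = 0 := by
  rw [eq_sub_of_add_eq h, map_sub, vectorState_one he, vectorState_ketbra_self he, sub_self]

lemma re_vectorState_ge {x : M2} {c : ℝ} (hx : (x - (c : ℂ) • (1 : M2)).PosSemidef) {e : H2}
    (he : ‖e‖ = 1) : c ≤ (vectorState e x).re := by
  have h := (vectorState_mem_stateSpace he).1 _ (Matrix.nonneg_iff_posSemidef.mpr hx)
  rw [map_sub, map_smul, vectorState_one he, smul_eq_mul, mul_one] at h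
  have := (Complex.nonneg_iff.mp h).1
  simpa using this

/-- Subtracting the least eigenvalue leaves a positive matrix. -/
lemma sub_least_eigenvalue_posSemidef {x : M2} (hx : x.IsHermitian) {c : ℝ}
    (hc : c ∈ lowerBounds (realEigenvalues x)) : (x - (c : ℂ) • (1 : M2)).PosSemidef := by
  set f := hx.eigenvectorBasis
  have hmul : ∀ i, x *ᵥ (f i).ofLp = ((hx.eigenvalues i : ℝ) : ℂ) • (f i).ofLp := fun i => by
    rw [Complex.coe_smul]; exact hx.mulVec_eigenvectorBasis i
  have hle : ∀ i, c ≤ hx.eigenvalues i := by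
    refine fun i => hc (mem_realEigenvalues_iff.mpr ⟨f i, ?_, ?_⟩)
    · exact f.orthonormal.ne_zero i
    · exact WithLp.ofLp_injective 2 (hmul i)
  have hone : ketbra (f 0) + ketbra (f 1) = 1 :=
    ketbra_add_ketbra (f.norm_eq_one 0) (f.norm_eq_one 1) (f.orthonormal.2 (by decide))
  have hket : ∀ i, x * ketbra (f i) = ((hx.eigenvalues i : ℝ) : ℂ) • ketbra (f i) := fun i => by
    rw [ketbra, Matrix.mul_vecMulVec, hmul, Matrix.smul_vecMulVec]
  have e : x - (c : ℂ) • (1 : M2) = ∑ i, ((hx.eigenvalues i - c : ℝ) : ℂ) • ketbra (f i) := by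
    have h1 : x * (ketbra (f 0) + ketbra (f 1)) = x := by rw [hone, mul_one]
    rw [mul_add, hket, hket] at h1
    conv_lhs => rw [← h1, ← hone]
    rw [Fin.sum_univ_two]
    push_cast
    module
  rw [e]
  refine Matrix.posSemidef_sum _ fun i _ => (ketbra_posSemidef _).smul ?_
  exact_mod_cast sub_nonneg.mpr (hle i)

/-- An eigenvalue is bounded below by every scalar lower bound of the matrix. -/
lemma le_of_mem_realEigenvalues {x : M2} {c r : ℝ} (hx : (x - (c : ℂ) • (1 : M2)).PosSemidef)
    (hr : r ∈ realEigenvalues x) : c ≤ r := by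
  obtain ⟨v, hv0, hv⟩ := mem_realEigenvalues_iff.mp hr
  have h := hx.dotProduct_mulVec_nonneg v.ofLp
  have hv' : x *ᵥ v.ofLp = (r : ℂ) • v.ofLp := congrArg WithLp.ofLp hv
  rw [Matrix.sub_mulVec, hv', Matrix.smul_mulVec, Matrix.one_mulVec, ← sub_smul,
    dotProduct_smul, smul_eq_mul] at h
  have hpos : 0 < star v.ofLp ⬝ᵥ v.ofLp := by
    refine Matrix.dotProduct_star_self_pos_iff.mpr fun h0 => hv0 ?_
    exact WithLp.ofLp_injective 2 h0
  have h2 : (0 : ℂ) ≤ (r : ℂ) - c := by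
    by_contra hn
    obtain ⟨s, hs⟩ : ∃ s : ℝ, star v.ofLp ⬝ᵥ v.ofLp = s :=
      ⟨_, (Complex.conj_eq_iff_re.mp (Complex.conj_eq_iff_im.mpr
        (Complex.nonneg_iff.mp hpos.le).2.symm)).symm⟩
    rw [hs] at h hpos
    have h' : 0 ≤ (r - c) * s := by exact_mod_cast h
    have hs' : 0 < s := by exact_mod_cast hpos
    exact hn (by exact_mod_cast nonneg_of_mul_nonneg_left h' hs')
  have : (0 : ℝ) ≤ r - c := by exact_mod_cast h2
  linarith

/-- An orthogonal measure has at most two atoms; the first one below has the larger weight. -/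
lemma IsOrthogonalMeasure.exists_two_atoms {x : M2} {μ : Measure PureState} (htr : x.trace = 1)
    (h : IsOrthogonalMeasure (densityState x) μ) :
    ∃ (f g : H2) (hf : ‖f‖ = 1) (hg : ‖g‖ = 1) (b : ℝ≥0), b ≤ 1 / 2 ∧
      ketbra f + ketbra g = 1 ∧
      x = ((1 - b : ℝ) : ℂ) • ketbra f + ((b : ℝ) : ℂ) • ketbra g ∧
      μ = ((1 - b : ℝ≥0) : ℝ≥0∞) • Measure.dirac (pureState f hf)
        + (b : ℝ≥0∞) • Measure.dirac (pureState g hg) := by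
  obtain ⟨e, a, hω, hμ⟩ := h
  have hx := densityState_injective hω
  rw [Fin.sum_univ_two] at hx hμ
  have h0 := e.norm_eq_one 0
  have h1 := e.norm_eq_one 1
  have hone : ketbra (e 0) + ketbra (e 1) = 1 :=
    ketbra_add_ketbra h0 h1 (e.orthonormal.2 (by decide))
  have hsum : a 0 + a 1 = 1 := by
    rw [hx, Matrix.trace_add, Matrix.trace_smul, Matrix.trace_smul, ketbra_trace h0,
      ketbra_trace h1, smul_eq_mul, smul_eq_mul, mul_one, mul_one] at htr
    have h' : (a 0 : ℝ) + (a 1 : ℝ) = 1 := by exact_mod_cast htr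
    exact_mod_cast h'
  have hsumR : (a 0 : ℝ) + (a 1 : ℝ) = 1 := by exact_mod_cast hsum
  rcases le_total (a 1) (a 0) with hle | hle
  · refine ⟨e 0, e 1, h0, h1, a 1, ?_, hone, ?_, ?_⟩
    · have : (a 1 : ℝ) ≤ (a 0 : ℝ) := hle
      exact NNReal.coe_le_coe.mp (by push_cast; linarith)
    · rw [hx, ← eq_sub_of_add_eq hsumR]
    · rw [hμ, ← hsum, add_tsub_cancel_right]
  · refine ⟨e 1, e 0, h1, h0, a 0, ?_, by rw [add_comm, hone], ?_, ?_⟩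
    · have : (a 0 : ℝ) ≤ (a 1 : ℝ) := hle
      exact NNReal.coe_le_coe.mp (by push_cast; linarith)
    · rw [hx, ← eq_sub_of_add_eq' hsumR, add_comm]
    · rw [hμ, ← hsum, add_tsub_cancel_left, add_comm]

instance : T2Space PureState :=
  inferInstanceAs (T2Space {ω : WeakDual ℂ M2 // ω ∈ Set.extremePoints ℝ stateSpace})

lemma tendsto_pureState {f : ℝ≥0 → H2} (hf : ∀ t, ‖f t‖ = 1) {e : H2} (he : ‖e‖ = 1)
    (h : Tendsto (fun t => ketbra (f t)) atTop (𝓝 (ketbra e))) :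
    Tendsto (fun t => pureState (f t) (hf t)) atTop (𝓝 (pureState e he)) :=
  tendsto_subtype_rng.mpr ((continuous_densityState.tendsto _).comp h)

/-! ### Two-sided exponential bounds. -/

/-- Exponential bounds for the evolution of a state other than the absorbing one. -/
lemma exists_decay_bounds {T : ℝ≥0 → (M2 →CP M2)} (hT : IsQuantumMarkovSemigroup T)
    {e₁ e₂ : H2} (he₁ : ‖e₁‖ = 1) (he₂ : ‖e₂‖ = 1) (horth : inner ℂ e₁ e₂ = 0)
    (habs : IsAbsorbing T (vectorState e₁)) {y z₁ z₂ : M2}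
    (hp : IsGeneratorParameters T e₁ y z₁ z₂) {η a : ℝ}
    (hη : IsGreatest (realEigenvalues (-(y + yᴴ))) η)
    (ha : a = ‖inner ℂ (act z₁ e₂) e₂‖ ^ 2 + ‖inner ℂ (act z₂ e₂) e₂‖ ^ 2) :
    a - η < 0 ∧ ∀ ρ, IsDensity ρ → densityState ρ ≠ vectorState e₁ →
      (∀ t, IsDensity (predualMatrix (T t) ρ)) ∧
      ∃ C D : ℝ, 0 < C ∧ 0 < D ∧
        (∀ᶠ t : ℝ≥0 in atTop, (predualMatrix (T t) ρ -
          ((C * Real.exp ((a - η) * t) : ℝ) : ℂ) • (1 : M2)).PosSemidef) ∧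
        ∀ t : ℝ≥0, (vectorState e₂ (predualMatrix (T t) ρ)).re =
          D * Real.exp ((a - η) * t) := by
  obtain ⟨r, w, q, h, hcf⟩ := exists_isChannelSemigroup hT he₁ he₂ horth habs
  have hWW := frame_conjTranspose_mul he₁ he₂ horth
  have hq' := hp.tendsto_q hWW hcf hη ha
  have hW0 := frame_single_zero (e₁ := e₁) (e₂ := e₂)
  have hW1 := frame_single_one (e₁ := e₁) (e₂ := e₂)
  have hvs := vectorState_right (e₁ := e₁) (e₂ := e₂)
  generalize frame e₁ e₂ = W at *
  have hWW' := mul_eq_one_comm.mp hWW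
  have hconj : ∀ x : M2, Wᴴ * (W * x * Wᴴ) * W = x := fun x => by
    simp only [← mul_assoc, hWW, one_mul]
    rw [mul_assoc, hWW, mul_one]
  have hconj' : ∀ x : M2, W * (Wᴴ * x * W) * Wᴴ = x := fun x => by
    simp only [← mul_assoc, hWW', one_mul]
    rw [mul_assoc, hWW', mul_one]
  have hcf' : ∀ t ρ, Wᴴ * predualMatrix (T t) ρ * W =
      channelForm (r t) (w t) (q t) (Wᴴ * ρ * W) := fun t ρ => by rw [← hcf, hconj']
  have hcont : ∀ (σ : M2) (i j : Fin 2),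
      Continuous fun t => channelForm (r t) (w t) (q t) σ i j := by
    intro σ i j
    simp only [← hcf]
    exact ((continuous_const.mul (hT.continuous_predualMatrix _)).mul continuous_const).matrix_elem
      i j
  have hqc : Continuous q := by
    have := Complex.continuous_re.comp (hcont (Matrix.single 1 1 1) 1 1)
    simpa [Function.comp_def, channelForm] using this
  have hrc : Continuous r := by
    simpa [channelForm] using hcont (Matrix.single 0 1 1) 0 1
  have hqexp := eq_exp_of_mul hqc h.q_zero h.q_add hq'
  have hneg : a - η < 0 := by
    -- Absorption applied to `|e₂⟩⟨e₂|`, whose `e₂`-population at time `t` is `q t`.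
    have hlim : Tendsto q atTop (𝓝 0) := by
      have h1 := habs.tendsto_predualMatrix ⟨ketbra_posSemidef e₂, ketbra_trace he₂⟩
      have h2 := (Complex.continuous_re.tendsto _).comp
        (tendsto_entry ((h1.const_mul Wᴴ).mul_const W) 1 1)
      rw [← hW0, ← hW1, hconj] at h2
      simpa [Function.comp_def, hcf, channelForm] using h2
    by_contra hge
    push Not at hge
    have : (1 : ℝ) ≤ 0 := ge_of_tendsto' hlim fun t => by
      rw [hqexp]
      exact Real.one_le_exp (mul_nonneg hge t.coe_nonneg)
    linarith
  refine ⟨hneg, fun ρ hρ hne => ?_⟩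
  have hσ : (Wᴴ * ρ * W).PosSemidef := hρ.1.conjTranspose_mul_mul_same W
  have hpsd : ∀ t, (predualMatrix (T t) ρ).PosSemidef := by
    intro t
    rw [← hconj' (predualMatrix (T t) ρ), hcf']
    exact (channelForm_posSemidef (h.form_nonneg t) hσ).mul_mul_conjTranspose_same W
  have hσ1 : (Wᴴ * ρ * W) 1 1 ≠ 0 := by
    intro h0
    refine hne (eq_vectorState (densityState_mem_stateSpace hρ) he₁ ?_)
    rw [← eq_sub_of_add_eq' (ketbra_add_ketbra he₁ he₂ horth), ← h0, ← hvs, vectorState,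
      densityState_apply, densityState_apply, Matrix.trace_mul_comm]
  have hσre : (((Wᴴ * ρ * W) 1 1).re : ℂ) = (Wᴴ * ρ * W) 1 1 :=
    Complex.conj_eq_iff_re.mp (hσ.1.apply 1 1)
  -- Any small positive time serves: `r` is continuous with `r 0 = 1`, and `q t < 1` at every
  -- positive time.
  obtain ⟨t, hrt, ht⟩ : ∃ t, r t ≠ 0 ∧ 0 < t := by
    have h1 : ∀ᶠ t in 𝓝[>] (0 : ℝ≥0), r t ≠ 0 := by
      refine (hrc.tendsto 0).eventually_ne ?_ |>.filter_mono nhdsWithin_le_nhds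
      rw [h.r_zero]; exact one_ne_zero
    obtain ⟨t, h2, h3⟩ := (h1.and self_mem_nhdsWithin).exists
    exact ⟨t, h2, h3⟩
  have hqt : q t < 1 := by
    rw [hqexp]
    rw [Real.exp_lt_one_iff]
    exact (mul_neg_of_neg_of_pos hneg (NNReal.coe_pos.mpr ht))
  obtain ⟨C, hC, hlow⟩ := h.exists_lower_bound hrt hqt hσ hσ1
  refine ⟨fun t => ⟨hpsd t, by rw [hT.trace_predualMatrix, hρ.2]⟩, C, ((Wᴴ * ρ * W) 1 1).re, hC,
    ?_, ?_, fun t => ?_⟩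
  · have h0 : 0 ≤ (Wᴴ * ρ * W) 1 1 := hσ.diag_nonneg
    refine lt_of_le_of_ne (Complex.nonneg_iff.mp h0).1 fun hz => hσ1 ?_
    rw [← hσre, ← hz, Complex.ofReal_zero]
  · filter_upwards [hlow] with t ht
    have := ht.mul_mul_conjTranspose_same W
    rw [← hcf', hqexp, mul_sub, sub_mul, hconj', mul_smul_comm, smul_mul_assoc, mul_one,
      hWW'] at this
    exact this
  · rw [hvs, hcf', ← hqexp]
    simp [channelForm, mul_comm]

end QMS

/-! ### Convergence of the eigenprojections and conclusion. -/

theorem mainTheorem1 (T : ℝ≥0 → (QMS.M2 →CP QMS.M2)) (hT : QMS.IsQuantumMarkovSemigroup T)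
    (e₁ e₂ : QMS.H2) (he₁ : ‖e₁‖ = 1) (he₂ : ‖e₂‖ = 1) (horth : inner ℂ e₁ e₂ = 0)
    (habs : QMS.IsAbsorbing T (QMS.vectorState e₁)) :
    (∃ y z₁ z₂ : QMS.M2, QMS.IsGeneratorParameters T e₁ y z₁ z₂) ∧
    ∀ y z₁ z₂ : QMS.M2, QMS.IsGeneratorParameters T e₁ y z₁ z₂ →
    ∀ η a : ℝ, IsGreatest (QMS.realEigenvalues (-(y + yᴴ))) η →
      a = ‖inner ℂ (QMS.act z₁ e₂) e₂‖ ^ 2 + ‖inner ℂ (QMS.act z₂ e₂) e₂‖ ^ 2 →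
    0 < η - a ∧
    ∀ ρ : QMS.M2, QMS.IsDensity ρ → QMS.densityState ρ ≠ QMS.vectorState e₁ →
      (∀ μ : ℝ≥0 → Measure QMS.PureState,
        (∀ t, QMS.IsOrthogonalMeasure (QMS.predual (T t) (QMS.densityState ρ)) (μ t)) →
        QMS.LargeDeviationPrinciple μ (QMS.rateFunction e₁ e₂ (ENNReal.ofReal (η - a))) ∧
        ∀ G : Set QMS.PureState, IsOpen G → QMS.pureState e₂ he₂ ∈ G →
          QMS.pureState e₁ he₁ ∉ closure G →
          Tendsto (fun t : ℝ≥0 => 1 / (t : ℝ) * Real.log ((μ t).real G)) atTop (𝓝 (a - η))) ∧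
      ∀ a₂ : ℝ≥0 → ℝ, (∀ t, IsLeast (QMS.realEigenvalues (QMS.predualMatrix (T t) ρ)) (a₂ t)) →
        Tendsto (fun t : ℝ≥0 => 1 / (t : ℝ) * Real.log (a₂ t)) atTop (𝓝 (a - η)) := by
  refine ⟨QMS.exists_isGeneratorParameters hT he₁ he₂ horth habs, ?_⟩
  intro y z₁ z₂ hp η a hη ha
  obtain ⟨hneg, hbounds⟩ := QMS.exists_decay_bounds hT he₁ he₂ horth habs hp hη ha
  refine ⟨by linarith, fun ρ hρ hne => ?_⟩
  obtain ⟨hdens, C, D, hC, hD, hlow, hup⟩ := hbounds ρ hρ hne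
  refine ⟨fun μ hμ => ?_, fun a₂ ha₂ => ?_⟩
  · have hdec := fun t => QMS.IsOrthogonalMeasure.exists_two_atoms (hdens t).2
      (by rw [QMS.predual_densityState]; exact hμ t)
    choose f g hf hg b hb hone hX hμeq using hdec
    have hblow : ∀ᶠ t : ℝ≥0 in atTop, C * Real.exp ((a - η) * t) ≤ b t := by
      filter_upwards [hlow] with t ht
      have h1 := QMS.re_vectorState_ge ht (hg t)
      rw [hX t, map_add, map_smul, map_smul, QMS.vectorState_ketbra_self (hg t),
        QMS.vectorState_ketbra_of_add (hg t) (hone t)] at h1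
      simpa using h1
    -- Since `b t` is the smaller weight, the evolved state minus `b t` is a nonnegative multiple of
    -- `ketbra (f t)`; it is tested at `e₂`.
    have hbup : ∀ t : ℝ≥0, (b t : ℝ) ≤ D * Real.exp ((a - η) * t) := by
      intro t
      rw [← hup t]
      refine QMS.re_vectorState_ge ?_ he₂
      have h2 : (b t : ℝ) ≤ 1 / 2 := by exact_mod_cast hb t
      have e : QMS.predualMatrix (T t) ρ - ((b t : ℝ) : ℂ) • (1 : QMS.M2) =
          ((1 - 2 * b t : ℝ) : ℂ) • QMS.ketbra (f t) := by
        rw [hX t, ← hone t]; push_cast; module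
      rw [e]
      refine (QMS.ketbra_posSemidef _).smul ?_
      exact_mod_cast (by linarith : (0 : ℝ) ≤ 1 - 2 * b t)
    have hlog := QMS.tendsto_inv_mul_log hC hD hblow (Eventually.of_forall hbup)
    have hexp : Tendsto (fun t : ℝ≥0 => D * Real.exp ((a - η) * t)) atTop (𝓝 0) := by
      have h1 : Tendsto (fun t : ℝ≥0 => (a - η) * (t : ℝ)) atTop atBot :=
        (NNReal.tendsto_coe_atTop.mpr tendsto_id).const_mul_atTop_of_neg hneg
      simpa using (Real.tendsto_exp_atBot.comp h1).const_mul D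
    have hb0 : Tendsto (fun t => (b t : ℝ)) atTop (𝓝 0) :=
      squeeze_zero (fun t => (b t).coe_nonneg) hbup hexp
    -- The same identity, divided by `1 - 2 b t`, expresses the eigenprojection through the
    -- convergent state; no choice of phases for `f t` is needed.
    have hfk : Tendsto (fun t => QMS.ketbra (f t)) atTop (𝓝 (QMS.ketbra e₁)) := by
      have hbc : Tendsto (fun t => ((b t : ℝ) : ℂ)) atTop (𝓝 0) := by
        exact_mod_cast (Complex.continuous_ofReal.tendsto 0).comp hb0
      have h1 : Tendsto (fun t => (1 - 2 * ((b t : ℝ) : ℂ))⁻¹) atTop (𝓝 1) := by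
        simpa using ((hbc.const_mul 2).const_sub 1).inv₀ (by simp)
      have h2 := h1.smul ((habs.tendsto_predualMatrix hρ).sub
        (hbc.smul_const (1 : QMS.M2)))
      rw [zero_smul, sub_zero, one_smul] at h2
      refine h2.congr' ?_
      filter_upwards [hb0.eventually (gt_mem_nhds (by norm_num : (0 : ℝ) < 1 / 2))] with t ht
      have hne : (1 - 2 * ((b t : ℝ) : ℂ)) ≠ 0 := by
        have : (1 - 2 * b t : ℝ) ≠ 0 := by
          intro h; linarith
        exact_mod_cast this
      have e : QMS.predualMatrix (T t) ρ - ((b t : ℝ) : ℂ) • (1 : QMS.M2) =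
          (1 - 2 * ((b t : ℝ) : ℂ)) • QMS.ketbra (f t) := by
        rw [hX t, ← hone t]; push_cast; module
      rw [e, smul_smul, inv_mul_cancel₀ hne, one_smul]
    have hgk : Tendsto (fun t => QMS.ketbra (g t)) atTop (𝓝 (QMS.ketbra e₂)) := by
      rw [eq_sub_of_add_eq' (QMS.ketbra_add_ketbra he₁ he₂ horth)]
      exact (hfk.const_sub 1).congr fun t => (eq_sub_of_add_eq' (hone t)).symm
    have hM := QMS.tendsto_pureState hf he₁ hfk
    have hm := QMS.tendsto_pureState hg he₂ hgk
    have h12 : QMS.vectorState e₂ ≠ QMS.vectorState e₁ := by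
      intro h
      have h1 := QMS.vectorState_ketbra_of_add he₂ (QMS.ketbra_add_ketbra he₁ he₂ horth)
      rw [h, QMS.vectorState_ketbra_self he₁] at h1
      exact one_ne_zero h1
    refine ⟨?_, fun G hG h2 h1 => ?_⟩
    · refine QMS.largeDeviationPrinciple_two_atoms (κ := η - a) (by linarith) hb hμeq hM hm ?_ ?_
        ?_ ?_ ?_
      · filter_upwards [hblow] with t ht
        have : 0 < C * Real.exp ((a - η) * t) := by positivity
        exact NNReal.coe_pos.mp (by linarith)
      · rwa [neg_sub]
      · simp [QMS.rateFunction, QMS.pureState]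
      · simp [QMS.rateFunction, QMS.pureState, h12]
      · intro x hx1 hx2
        have n1 : x.1 ≠ QMS.vectorState e₁ := fun h => hx1 (Subtype.ext h)
        have n2 : x.1 ≠ QMS.vectorState e₂ := fun h => hx2 (Subtype.ext h)
        simp [QMS.rateFunction, n1, n2]
    · refine hlog.congr' ?_
      filter_upwards [QMS.two_atoms_real_eq hμeq hM hm hG h2 h1] with t ht
      rw [ht]
  · refine QMS.tendsto_inv_mul_log hC hD ?_ (Eventually.of_forall fun t => ?_)
    · filter_upwards [hlow] with t ht
      exact QMS.le_of_mem_realEigenvalues ht (ha₂ t).1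
    · rw [← hup t]
      exact QMS.re_vectorState_ge
        (QMS.sub_least_eigenvalue_posSemidef (hdens t).1.1 (ha₂ t).2) he₂
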